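/- Conventions. All manifolds are smooth, finite-dimensional and second countable Hausdorff; curves are piecewise smooth. For a curve $\gamma$ in a semi-Riemannian manifold, $P_\gamma$ denotes the parallel transport along $\gamma$ with respect to the Levi-Civita connection (it exists and is unique for every piecewise smooth curve), and $\mathrm{Hol}_p(M)=\{P_\gamma \mid \gamma \text{ a loop at } p\}\subset \mathrm{GL}(T_pM)$ is the holonomy group at $p$. A group $\Gamma$ of diffeomorphisms of a manifold $N$ is properly discontinuous if (PD1) each $x\in N$ has a neighbourhood $U$ with $\sigma(U)\cap U=\emptyset$ for all $\sigma\in\Gamma\setminus\{1\}$, and (PD2) any two points $x,y$ in different $\Gamma$-orbits have neighbourhoods $U_x,U_y$ with $\sigma(U_x)\cap U_y=\emptyset$ for all $\sigma\in\Gamma$. **Proposition.** Let $\widetilde M$ be a connected semi-Riemannian manifold, $\Gamma$ a properly discontinuous group of isometries of $\widetilde M$, and $\pi:\widetilde M\to M=\widetilde M/\Gamma$ the induced semi-Riemannian covering. Let $\widetilde p\in\widetilde M$ and $p=\pi(\widetilde p)$. Write $\widetilde P$ and $P$ for the parallel transports in $\widetilde M$ and $M$. (i) The map $\iota:\mathrm{Hol}_{\widetilde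 p}(\widetilde M)\to \mathrm{Hol}_p(M)$, $\widetilde P_{\widetilde\gamma}\mapsto P_{\pi\circ\widetilde\gamma}$, for $\widetilde\gamma$ a loop at $\widetilde p$, is a well-defined injective group homomorphism, and its image is a normal subgroup of $\mathrm{Hol}_p(M)$. (ii) The map $\Phi:\Gamma\to \mathrm{Hol}_p(M)/\iota(\mathrm{Hol}_{\widetilde p}(\widetilde M))$, $\sigma\mapsto[P_\gamma]$, where $\gamma$ is a loop at $p$ whose lift starting at $\widetilde p$ ends at $\sigma^{-1}(\widetilde p)$ (such a loop exists for every $\sigma\in\Gamma$), is a well-defined surjective group homomorphism. (iii) Let $\gamma$ be a loop at $p$. Then its lift $\widetilde\gamma$ starting at $\widetilde p$ ends at $\sigma^{-1}(\widetilde p)$ for a unique $\sigma\in\Gamma$, is piecewise smooth, and, identifying $T_pM$ with $T_{\widetilde p}\widetilde M$ by $d\pi_{\widetilde p}$, $$P_\gamma = d\sigma_{\sigma^{-1}(\widetilde p)}\circ\widetilde P_{\widetilde\gamma}.$$ In particular, for every $\sigma\in\Gamma$ and every curve $\widetilde\gamma$ from $\widetilde p$ to $\sigma^{-1}(\widetilde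 p)$, the map $\phi(\sigma):= d\sigma_{\sigma^{-1}(\widetilde p)}\circ\widetilde P_{\widetilde\gamma} = \big((d\sigma^{-1})_{\widetilde p}\big)^{-1}\circ\widetilde P_{\widetilde\gamma}$ is, under this identification, an element of $\mathrm{Hol}_p(M)$ representing $\Phi(\sigma)$. -/

import Mathlib

open Set
open scoped Manifold ContDiff Topology

set_option linter.unusedSectionVars false

noncomputable section

namespace HolonomyCovering

variable {E : Type*} [NormedAddCommGroup E] [NormedSpace ℝ E] [FiniteDimensional ℝ E]
variable {M : Type*} [TopologicalSpace M] [ChartedSpace E M] [IsManifold 𝓘(ℝ, E) ∞ M]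
variable {N : Type*} [TopologicalSpace N] [ChartedSpace E N] [IsManifold 𝓘(ℝ, E) ∞ N]

variable (E M) in
/-- A semi-Riemannian metric on the smooth manifold `M` (modelled on the finite-dimensional real
vector space `E`): a smooth field of symmetric, nondegenerate bilinear forms of arbitrary
signature on the tangent spaces. -/
structure SemiRiemannianMetric where
  /-- The scalar product on each tangent space. -/
  inner (x : M) : TangentSpace 𝓘(ℝ, E) x →L[ℝ] TangentSpace 𝓘(ℝ, E) x →L[ℝ] ℝ
  symm (x : M) (v w : TangentSpace 𝓘(ℝ, E) x) : inner x v w = inner x w v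
  nondegenerate (x : M) (v : TangentSpace 𝓘(ℝ, E) x) (hv : ∀ w, inner x v w = 0) : v = 0
  contMDiff : ContMDiff 𝓘(ℝ, E) (𝓘(ℝ, E).prod 𝓘(ℝ, E →L[ℝ] E →L[ℝ] ℝ)) ∞
    (fun x ↦ Bundle.TotalSpace.mk' (E →L[ℝ] E →L[ℝ] ℝ)
      (E := fun x : M ↦ TangentSpace 𝓘(ℝ, E) x →L[ℝ] TangentSpace 𝓘(ℝ, E) x →L[ℝ] ℝ)
      x (inner x))

/-! ### The Levi-Civita connection in charts -/

/-- The metric in the chart `e`: the bilinear form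
`(u, v) ↦ g (d(e⁻¹)_y u, d(e⁻¹)_y v)` on `E`, for `y` in the image of the chart. -/
def coordMetric (g : SemiRiemannianMetric E M) (e : OpenPartialHomeomorph M E) (y : E) :
    E →L[ℝ] E →L[ℝ] ℝ :=
  let G : E →L[ℝ] E →L[ℝ] ℝ := g.inner (e.symm y)
  let D : E →L[ℝ] E := mfderiv 𝓘(ℝ, E) 𝓘(ℝ, E) e.symm y
  G.bilinearComp D D

/-- The right-hand side of the Koszul formula for the coordinate vector fields `u`, `v`, `w`:
`w ↦ ½ (∂_u G (v, w) + ∂_v G (u, w) - ∂_w G (u, v))`, where `G` is the metric in the chart `e`. -/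
def koszulForm (g : SemiRiemannianMetric E M) (e : OpenPartialHomeomorph M E) (y u v : E) :
    E →L[ℝ] ℝ :=
  (1 / 2 : ℝ) • (fderiv ℝ (coordMetric g e) y u v + fderiv ℝ (coordMetric g e) y v u
    - ((fderiv ℝ (coordMetric g e) y).flip u).flip v)

/-- The Christoffel map of the Levi-Civita connection in the chart `e`: `christoffel g e y u v`
is the covariant derivative `∇_u v` at `y` of the coordinate vector field `v` in direction `u`,
that is, the vector representing the Koszul form with respect to the (nondegenerate) metric
`coordMetric g e y`. -/
def christoffel (g : SemiRiemannianMetric E M) (e : OpenPartialHomeomorph M E) (y u v : E) : E :=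
  ContinuousLinearMap.inverse (coordMetric g e y) (koszulForm g e y u v)

/-- The coordinate vector `de_x v` of the tangent vector `⟨x, v⟩` in the chart `e`. -/
def coordVec (e : OpenPartialHomeomorph M E) (ξ : TangentBundle 𝓘(ℝ, E) M) : E :=
  (mfderiv 𝓘(ℝ, E) 𝓘(ℝ, E) e ξ.proj : TangentSpace 𝓘(ℝ, E) ξ.proj →L[ℝ] E) ξ.2

/-! ### Piecewise smooth curves and parallel transport -/

/-- The curve `γ : [0, 1] → M` is piecewise smooth: there is a finite set `S` of break points such
that `γ` is smooth on every closed subinterval of `[0, 1]` without break points in its interior. -/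
def PiecewiseSmooth {x y : M} (γ : Path x y) : Prop :=
  ∃ S : Set ℝ, S.Finite ∧ ∀ a b : ℝ, 0 ≤ a → a < b → b ≤ 1 → Disjoint (Ioo a b) S →
    ContMDiffOn 𝓘(ℝ, ℝ) 𝓘(ℝ, E) ∞ γ.extend (Icc a b)

/-- The vector field `X` along the curve `c` is differentiable with vanishing covariant derivative
on the interval `[a, b]`: in every chart, `V' + Γ(c', V) = 0`, where `c` and `V` are the
coordinate expressions of the curve and of the field, and `Γ` is the Christoffel map of the
Levi-Civita connection. -/
def IsParallelOn (g : SemiRiemannianMetric E M) (c : ℝ → M) (X : ℝ → TangentBundle 𝓘(ℝ, E) M)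
    (a b : ℝ) : Prop :=
  ∀ t ∈ Icc a b, ∀ e ∈ atlas E M, c t ∈ e.source →
    ∃ u : E, HasDerivWithinAt (fun s ↦ e (c s)) u (Icc a b) t ∧
      HasDerivWithinAt (fun s ↦ coordVec e (X s))
        (-christoffel g e (e (c t)) u (coordVec e (X t))) (Icc a b) t

/-- `X` is a parallel vector field along the piecewise smooth curve `γ`: on every smooth piece of
`γ` (the pieces being cut out by some finite set `S`), `X` is differentiable with
vanishing covariant derivative. The pieces are closed intervals, so `X` is continuous on `[0, 1]`;
the values of `X` outside `[0, 1]` are irrelevant. -/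
def IsParallelAlong (g : SemiRiemannianMetric E M) {x y : M} (γ : Path x y)
    (X : ℝ → TangentBundle 𝓘(ℝ, E) M) : Prop :=
  (∀ t ∈ Icc (0 : ℝ) 1, (X t).proj = γ.extend t) ∧
  ∃ S : Set ℝ, S.Finite ∧ ∀ a b : ℝ, 0 ≤ a → a < b → b ≤ 1 → Disjoint (Ioo a b) S →
    ContMDiffOn 𝓘(ℝ, ℝ) 𝓘(ℝ, E) ∞ γ.extend (Icc a b) ∧ IsParallelOn g γ.extend X a b

/-- `A : T_x M → T_y M` is the parallel transport `P_γ` along the piecewise smooth curve `γ` from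
`x` to `y`, with respect to the Levi-Civita connection of `g`: each `v` is carried to `A v` by a
parallel vector field along `γ`. (For `v = 0` this contains that `γ` is piecewise smooth.) -/
def IsParallelTransport (g : SemiRiemannianMetric E M) {x y : M} (γ : Path x y)
    (A : TangentSpace 𝓘(ℝ, E) x ≃L[ℝ] TangentSpace 𝓘(ℝ, E) y) : Prop :=
  ∀ v : TangentSpace 𝓘(ℝ, E) x, ∃ X : ℝ → TangentBundle 𝓘(ℝ, E) M,
    IsParallelAlong g γ X ∧ X 0 = ⟨x, v⟩ ∧ X 1 = ⟨y, A v⟩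

/-! ### The holonomy group -/

theorem christoffel_smul_left (g : SemiRiemannianMetric E M) (e : OpenPartialHomeomorph M E)
    (k : ℝ) (y u v : E) : christoffel g e y (k • u) v = k • christoffel g e y u v := by
  have h : koszulForm g e y (k • u) v = k • koszulForm g e y u v := by
    ext w
    simp only [koszulForm, map_smul, smul_apply, add_apply, sub_apply,
      ContinuousLinearMap.flip_apply, smul_eq_mul]
    ring
  simp only [christoffel, h, map_smul]

/-- Affine reparametrization of parallel fields. -/
theorem IsParallelOn.comp_affine {g : SemiRiemannianMetric E M} {c c' : ℝ → M}
    {X X' : ℝ → TangentBundle 𝓘(ℝ, E) M} {a b a' b' k d : ℝ}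
    (h : IsParallelOn g c X a b) (hmap : MapsTo (fun s ↦ k * s + d) (Icc a' b') (Icc a b))
    (hc : ∀ s ∈ Icc a' b', c' s = c (k * s + d)) (hX : ∀ s ∈ Icc a' b', X' s = X (k * s + d)) :
    IsParallelOn g c' X' a' b' := by
  intro t ht e he hte
  rw [hc t ht] at hte
  obtain ⟨u, hu, hV⟩ := h _ (hmap ht) e he hte
  have hd : HasDerivWithinAt (fun s : ℝ ↦ k * s + d) k (Icc a' b') t := by
    simpa using ((hasDerivAt_id t).const_mul k |>.add_const d).hasDerivWithinAt
  refine ⟨k • u, ?_, ?_⟩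
  · exact (hu.scomp t hd hmap).congr (fun s hs ↦ by simp [hc s hs]) (by simp [hc t ht])
  · have := (hV.scomp t hd hmap).congr (f₁ := fun s ↦ coordVec e (X' s))
      (fun s hs ↦ by simp [hX s hs]) (by simp [hX t ht])
    rwa [hc t ht, hX t ht, christoffel_smul_left, ← smul_neg]

theorem contMDiffOn_comp_affine {c c' : ℝ → M} {a b a' b' k d : ℝ}
    (h : ContMDiffOn 𝓘(ℝ, ℝ) 𝓘(ℝ, E) ∞ c (Icc a b))
    (hmap : MapsTo (fun s ↦ k * s + d) (Icc a' b') (Icc a b))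
    (hc : ∀ s ∈ Icc a' b', c' s = c (k * s + d)) :
    ContMDiffOn 𝓘(ℝ, ℝ) 𝓘(ℝ, E) ∞ c' (Icc a' b') := by
  have hd : ContMDiff 𝓘(ℝ, ℝ) 𝓘(ℝ, ℝ) ∞ (fun s : ℝ ↦ k * s + d) := by
    rw [contMDiff_iff_contDiff]
    fun_prop
  exact (h.comp hd.contMDiffOn hmap).congr hc

theorem IsParallelTransport.piecewiseSmooth {g : SemiRiemannianMetric E M} {x y : M} {γ : Path x y}
    {A : TangentSpace 𝓘(ℝ, E) x ≃L[ℝ] TangentSpace 𝓘(ℝ, E) y} (h : IsParallelTransport g γ A) :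
    PiecewiseSmooth (E := E) γ := by
  obtain ⟨X, ⟨-, S, hS, hX⟩, -⟩ := h 0
  exact ⟨S, hS, fun a b ha hab hb hd ↦ (hX a b ha hab hb hd).1⟩

theorem IsParallelTransport.refl (g : SemiRiemannianMetric E M) (x : M) :
    IsParallelTransport g (Path.refl x) (ContinuousLinearEquiv.refl ℝ _) := by
  intro v
  refine ⟨fun _ ↦ ⟨x, v⟩, ⟨fun t _ ↦ by simp, ∅, finite_empty, fun a b _ _ _ _ ↦ ⟨?_, ?_⟩⟩,
    rfl, rfl⟩
  · exact (contMDiff_const (c := x)).contMDiffOn.congr (fun s _ ↦ by simp)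
  · intro t _ e _ _
    refine ⟨0, ?_, ?_⟩
    · simpa using hasDerivWithinAt_const t (Icc a b) (e x)
    · have h0 : ∀ y w : E, christoffel g e y 0 w = 0 := fun y w ↦ by
        simpa using christoffel_smul_left g e 0 y 0 w
      rw [h0, neg_zero]
      exact hasDerivWithinAt_const ..

theorem IsParallelTransport.symm {g : SemiRiemannianMetric E M} {x y : M} {γ : Path x y}
    {A : TangentSpace 𝓘(ℝ, E) x ≃L[ℝ] TangentSpace 𝓘(ℝ, E) y} (h : IsParallelTransport g γ A) :
    IsParallelTransport g γ.symm A.symm := by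
  intro v
  obtain ⟨X, ⟨hp, S, hS, hX⟩, h0, h1⟩ := h (A.symm v)
  refine ⟨fun t ↦ X (1 - t), ⟨fun t ht ↦ ?_, (fun t ↦ 1 - t) '' S, hS.image _,
    fun a b ha hab hb hdis ↦ ?_⟩, by simpa using h1, by simpa using h0⟩
  · rw [Path.extend_symm_apply]
    exact hp _ ⟨by linarith [ht.2], by linarith [ht.1]⟩
  · obtain ⟨hs, hpar⟩ := hX (1 - b) (1 - a) (by linarith) (by linarith) (by linarith) (by
      rw [Set.disjoint_left] at hdis ⊢
      intro s hs hsS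
      exact hdis (a := 1 - s) ⟨by linarith [hs.2], by linarith [hs.1]⟩ ⟨s, hsS, rfl⟩)
    have hmap : MapsTo (fun s : ℝ ↦ -1 * s + 1) (Icc a b) (Icc (1 - b) (1 - a)) :=
      fun s hs ↦ ⟨by linarith [hs.2], by linarith [hs.1]⟩
    have he : ∀ s : ℝ, 1 - s = -1 * s + 1 := fun s ↦ by ring
    exact ⟨contMDiffOn_comp_affine hs hmap
        (fun s _ ↦ by rw [Path.extend_symm_apply, he]),
      hpar.comp_affine hmap (fun s _ ↦ by rw [Path.extend_symm_apply, he]) (fun s _ ↦ by rw [he])⟩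

theorem IsParallelTransport.trans {g : SemiRiemannianMetric E M} {x y z : M}
    {γ : Path x y} {δ : Path y z}
    {A : TangentSpace 𝓘(ℝ, E) x ≃L[ℝ] TangentSpace 𝓘(ℝ, E) y}
    {B : TangentSpace 𝓘(ℝ, E) y ≃L[ℝ] TangentSpace 𝓘(ℝ, E) z}
    (hA : IsParallelTransport g γ A) (hB : IsParallelTransport g δ B) :
    IsParallelTransport g (γ.trans δ) (A.trans B) := by
  intro v
  obtain ⟨X, ⟨hXp, S, hS, hX⟩, hX0, hX1⟩ := hA v
  obtain ⟨Y, ⟨hYp, T, hT, hY⟩, hY0, hY1⟩ := hB (A v)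
  let Z : ℝ → TangentBundle 𝓘(ℝ, E) M := fun t ↦ if t ≤ 1 / 2 then X (2 * t) else Y (2 * t - 1)
  have hZ1 : ∀ t : ℝ, t ≤ 1 / 2 → Z t = X (2 * t + 0) := fun t ht ↦ by simp only [Z, if_pos ht, add_zero]
  have hZ2 : ∀ t : ℝ, 1 / 2 ≤ t → Z t = Y (2 * t + -1) := fun t ht ↦ by
    rcases ht.eq_or_lt with rfl | ht
    · rw [hZ1 _ le_rfl]
      norm_num [hX1, hY0]
    · simp only [Z, if_neg (not_le.2 ht), sub_eq_add_neg]
  have hc1 : ∀ t : ℝ, t ≤ 1 / 2 → (γ.trans δ).extend t = γ.extend (2 * t + 0) := fun t ht ↦ by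
    rw [Path.extend_trans_of_le_half _ _ ht, add_zero]
  have hc2 : ∀ t : ℝ, 1 / 2 ≤ t → (γ.trans δ).extend t = δ.extend (2 * t + -1) := fun t ht ↦ by
    rw [Path.extend_trans_of_half_le _ _ ht, sub_eq_add_neg]
  refine ⟨Z, ⟨fun t ht ↦ ?_, {1 / 2} ∪ ((fun s ↦ s / 2) '' S ∪ (fun s ↦ (s + 1) / 2) '' T),
    (finite_singleton _).union ((hS.image _).union (hT.image _)),
    fun a b ha hab hb hdis ↦ ?_⟩, ?_, ?_⟩
  · rcases le_total t (1 / 2) with h | h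
    · rw [hZ1 t h, hc1 t h]
      exact hXp _ ⟨by linarith [ht.1], by linarith⟩
    · rw [hZ2 t h, hc2 t h]
      exact hYp _ ⟨by linarith, by linarith [ht.2]⟩
  · rw [Set.disjoint_left] at hdis
    have hhalf : b ≤ 1 / 2 ∨ 1 / 2 ≤ a := by
      by_contra! hcon
      exact hdis (a := 1 / 2) ⟨hcon.2, hcon.1⟩ (Or.inl rfl)
    rcases hhalf with h | h
    · obtain ⟨hs, hpar⟩ := hX (2 * a) (2 * b) (by linarith) (by linarith) (by linarith) (by
        rw [Set.disjoint_left]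
        intro s hs hsS
        exact hdis (a := s / 2) ⟨by linarith [hs.1], by linarith [hs.2]⟩
          (Or.inr (Or.inl ⟨s, hsS, rfl⟩)))
      have hmap : MapsTo (fun s : ℝ ↦ 2 * s + 0) (Icc a b) (Icc (2 * a) (2 * b)) :=
        fun s hs ↦ ⟨by linarith [hs.1], by linarith [hs.2]⟩
      exact ⟨contMDiffOn_comp_affine hs hmap (fun s hs ↦ hc1 s (hs.2.trans h)),
        hpar.comp_affine hmap (fun s hs ↦ hc1 s (hs.2.trans h)) (fun s hs ↦ hZ1 s (hs.2.trans h))⟩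
    · obtain ⟨hs, hpar⟩ := hY (2 * a - 1) (2 * b - 1) (by linarith) (by linarith) (by linarith) (by
        rw [Set.disjoint_left]
        intro s hs hsS
        exact hdis (a := (s + 1) / 2) ⟨by linarith [hs.1], by linarith [hs.2]⟩
          (Or.inr (Or.inr ⟨s, hsS, rfl⟩)))
      have hmap : MapsTo (fun s : ℝ ↦ 2 * s + -1) (Icc a b) (Icc (2 * a - 1) (2 * b - 1)) :=
        fun s hs ↦ ⟨by linarith [hs.1], by linarith [hs.2]⟩
      exact ⟨contMDiffOn_comp_affine hs hmap (fun s hs ↦ hc2 s (h.trans hs.1)),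
        hpar.comp_affine hmap (fun s hs ↦ hc2 s (h.trans hs.1)) (fun s hs ↦ hZ2 s (h.trans hs.1))⟩
  · rw [hZ1 0 (by norm_num)]
    simpa using hX0
  · rw [hZ2 1 (by norm_num)]
    norm_num [hY1]

/-- The holonomy group `Hol_p(M, g)`: the group of all parallel transports along piecewise smooth
loops at `p`. -/
def holonomyGroup (g : SemiRiemannianMetric E M) (p : M) :
    Subgroup (TangentSpace 𝓘(ℝ, E) p ≃L[ℝ] TangentSpace 𝓘(ℝ, E) p) where
  carrier := {A | ∃ γ : Path p p, PiecewiseSmooth (E := E) γ ∧ IsParallelTransport g γ A}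
  mul_mem' := by
    rintro A B ⟨γ, -, hA⟩ ⟨δ, -, hB⟩
    exact ⟨δ.trans γ, (hB.trans hA).piecewiseSmooth, hB.trans hA⟩
  one_mem' := ⟨Path.refl p, (IsParallelTransport.refl g p).piecewiseSmooth,
    IsParallelTransport.refl g p⟩
  inv_mem' := by
    rintro A ⟨γ, -, hA⟩
    exact ⟨γ.symm, hA.symm.piecewiseSmooth, hA.symm⟩

/-! ### Isometries, properly discontinuous groups and semi-Riemannian coverings -/

/-- The map `f : M → N` preserves the metrics: `h (df v, df w) = g (v, w)`. -/
def PreservesMetric (g : SemiRiemannianMetric E M) (h : SemiRiemannianMetric E N)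
    (f : M → N) : Prop :=
  ∀ (x : M) (v w : TangentSpace 𝓘(ℝ, E) x),
    h.inner (f x) (mfderiv 𝓘(ℝ, E) 𝓘(ℝ, E) f x v) (mfderiv 𝓘(ℝ, E) 𝓘(ℝ, E) f x w)
      = g.inner x v w

/-- The group `Γ` acts properly discontinuously on the space `X` (in the strong sense that makes
the quotient a Hausdorff manifold and the projection a covering map). -/
structure ActsProperlyDiscontinuously (Γ X : Type*) [Group Γ] [TopologicalSpace X]
    [MulAction Γ X] : Prop where
  /-- Each point has a neighbourhood that is disjoint from all its translates. -/
  pd1 (x : X) : ∃ U ∈ 𝓝 x, ∀ σ : Γ, σ ≠ 1 → Disjoint ((fun z : X ↦ σ • z) '' U) U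
  /-- Points in different orbits have neighbourhoods whose translates do not meet. -/
  pd2 (x y : X) (hxy : x ∉ MulAction.orbit Γ y) :
    ∃ U ∈ 𝓝 x, ∃ V ∈ 𝓝 y, ∀ σ : Γ, Disjoint ((fun z : X ↦ σ • z) '' U) V

/-- The group `Γ` acts on `M` by isometries of `g`. (The inverse of `x ↦ σ • x` is
`x ↦ σ⁻¹ • x`, so that each `σ` acts by a diffeomorphism.) -/
structure ActsByIsometries (Γ : Type*) [Group Γ] [MulAction Γ M]
    (g : SemiRiemannianMetric E M) : Prop where
  contMDiff (σ : Γ) : ContMDiff 𝓘(ℝ, E) 𝓘(ℝ, E) ∞ (fun x : M ↦ σ • x)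
  preservesMetric (σ : Γ) : PreservesMetric g g (fun x : M ↦ σ • x)

/-- The semi-Riemannian covering `π : M → N`: a smooth covering map that preserves the metrics. -/
structure IsSemiRiemannianCovering (g : SemiRiemannianMetric E M) (h : SemiRiemannianMetric E N)
    (π : M → N) : Prop where
  isCoveringMap : IsCoveringMap π
  surjective : Function.Surjective π
  isLocalDiffeomorph : IsLocalDiffeomorph 𝓘(ℝ, E) 𝓘(ℝ, E) ∞ π
  preservesMetric : PreservesMetric g h π

/-- The differential `dσ_{σ⁻¹x} : T_{σ⁻¹x} M → T_x M` of the action of `σ`. (The tangent spaces at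
the equal points `σ • σ⁻¹ • x` and `x` are identified; both are `E` by definition.) -/
def actionDifferential {Γ : Type*} [Group Γ] [MulAction Γ M] (σ : Γ) (x : M) :
    TangentSpace 𝓘(ℝ, E) (σ⁻¹ • x) →L[ℝ] TangentSpace 𝓘(ℝ, E) x :=
  mfderiv 𝓘(ℝ, E) 𝓘(ℝ, E) (fun y : M ↦ σ • y) (σ⁻¹ • x)

end HolonomyCovering

end

/-! The Levi-Civita connection is determined by the metric, so a smooth map preserving the metrics
carries parallel fields to parallel fields. In charts, the Christoffel maps correspond up to the
second derivative of the coordinate expression (`christoffel_coordMap`), and this is exactly the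
term that the product rule adds when a field is pushed forward (`IsParallelAt.map`). The identity
map is a special case and gives independence of the chart. Consequently transport along `π ∘ γ'` is
transport along `γ'` conjugated by the differentials of `π`. For loops at `p'` this is conjugation
by one fixed isomorphism, which makes `ι` well defined and injective (`holonomyMap`).

Parallel transport itself comes from a linear differential equation, solved on short intervals and
glued by compactness. Uniqueness and linearity do not use uniqueness of solutions: scalar products
of parallel fields are constant, every vector at the end point is reached by transporting back along
the reversed curve, and the metric is nondegenerate (`existsUnique_isParallelTransport`).

The group theory rests on the relation `IsHolonomyOver` between `Γ` and the holonomy group of the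
base. It is closed under products and inverses, because lifts can be concatenated after translation
by an element of `Γ`. Path lifting provides a partner for each holonomy transformation, and
connectedness of the covering space provides one for each `σ`. The elements over `1` are those of
the image of `ι` (`isHolonomyOver_one_iff`), since a loop with closed lift is the projection of a
loop. Normality of the image and all properties of `Φ` are then formal. The formula for the
transport combines naturality under `π` with `π ∘ σ = π` (`transport_eq_of_lift`). -/

noncomputable section

namespace HolonomyCovering

/-! ### Gluing on compact intervals and linear differential equations -/

/-- A reflexive and transitive relation between points of a compact interval that holds locally, for
each pair of points close to a given one, holds for the end points. -/
theorem relation_Icc_of_locally {a b : ℝ} (hab : a ≤ b) (P : ℝ → ℝ → Prop)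
    (trans : ∀ r s t, a ≤ r → r ≤ s → s ≤ t → t ≤ b → P r s → P s t → P r t)
    (loc : ∀ t ∈ Icc a b, ∃ ε > 0, ∀ r s, a ≤ r → r ≤ s → s ≤ b → |r - t| < ε → |s - t| < ε →
      P r s) : P a b := by
  choose! ε hε hP using loc
  let c : Icc a b → Set (Icc a b) := fun t ↦ Metric.ball t (ε t)
  obtain ⟨t, ht0, htm, ⟨m, hm⟩, hc⟩ := exists_monotone_Icc_subset_open_cover_Icc hab (c := c)
    (fun i ↦ Metric.isOpen_ball)
    (fun t _ ↦ mem_iUnion.2 ⟨t, Metric.mem_ball_self (hε t t.2)⟩)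
  have step : ∀ n, P (t n) (t (n + 1)) := fun n ↦ by
    obtain ⟨i, hi⟩ := hc n
    exact hP i i.2 _ _ (t n).2.1 (htm n.le_succ) (t (n + 1)).2.2
      (by simpa [c, Subtype.dist_eq, Real.dist_eq] using hi (left_mem_Icc.2 (htm n.le_succ)))
      (by simpa [c, Subtype.dist_eq, Real.dist_eq] using hi (right_mem_Icc.2 (htm n.le_succ)))
  have key : ∀ n, P (t 0) (t (n + 1)) := fun n ↦ by
    induction n with
    | zero => exact step 0
    | succ k ih =>
      exact trans _ _ _ (t 0).2.1 (htm (Nat.zero_le _)) (htm (Nat.le_succ _)) (t (k + 2)).2.2 ih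
        (step (k + 1))
  have := key m
  rwa [hm _ (Nat.le_succ m), ht0] at this

/-- Existence of a gap around each point of a finite set of reals. -/
theorem exists_gap {S : Set ℝ} (hS : S.Finite) (t : ℝ) :
    ∃ ε > 0, ∀ s ∈ S, |s - t| < ε → s = t := by
  have h : (S \ {t})ᶜ ∈ 𝓝 t := (hS.subset sdiff_subset).isClosed.isOpen_compl.mem_nhds (by simp)
  obtain ⟨ε, hε, hb⟩ := Metric.mem_nhds_iff.1 h
  refine ⟨ε, hε, fun s hs hst ↦ ?_⟩
  by_contra hne
  exact hb (by rwa [Metric.mem_ball, Real.dist_eq]) ⟨hs, hne⟩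

/-- A linear differential equation with continuous coefficients is solvable on an interval that is
short in terms of the coefficients. -/
theorem exists_linear_ode_solution {F : Type*} [NormedAddCommGroup F] [NormedSpace ℝ F]
    [CompleteSpace F] {A : ℝ → F →L[ℝ] F} {a b : ℝ} {K : NNReal} (hab : a ≤ b)
    (hA : ContinuousOn A (Icc a b)) (hK : ∀ t ∈ Icc a b, ‖A t‖ ≤ K) (hshort : 2 * K * (b - a) ≤ 1)
    (v : F) : ∃ V : ℝ → F, V a = v ∧
      ∀ t ∈ Icc a b, HasDerivWithinAt V (A t (V t)) (Icc a b) t := by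
  -- On the ball of radius `‖v‖ + 1` about `v` one has `‖x‖ ≤ 2‖v‖ + 1`, so the speed is at most
  -- `K(2‖v‖ + 1)`. The solution stays in the ball as soon as `2K(b - a) ≤ 1`, a condition
  -- independent of `v`.
  have hpl : IsPicardLindelof (fun t x ↦ A t x) (⟨a, left_mem_Icc.2 hab⟩ : Icc a b) v
      (‖v‖₊ + 1) 0 (K * (2 * ‖v‖₊ + 1)) K := by
    constructor
    · intro t ht
      exact ((A t).lipschitz.weaken (hK t ht)).lipschitzOnWith
    · intro x _
      exact hA.clm_apply continuousOn_const
    · intro t ht x hx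
      have hx' : ‖x‖ ≤ 2 * ‖v‖ + 1 := by
        have h1 : dist x v ≤ ‖v‖ + 1 := by simpa using hx
        have h2 := norm_le_norm_add_norm_sub v x
        rw [dist_eq_norm, norm_sub_rev] at h1
        rw [norm_sub_rev] at h2
        rw [norm_sub_rev] at h1
        linarith [norm_le_insert' x v]
      calc ‖A t x‖ ≤ ‖A t‖ * ‖x‖ := (A t).le_opNorm x
        _ ≤ K * (2 * ‖v‖ + 1) := by gcongr; exact hK t ht
        _ = _ := by push_cast; rfl
    · have h0 : max (b - a) (a - a) = b - a := by
        rw [sub_self]; exact max_eq_left (by linarith)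
      push_cast
      rw [h0]
      have hv := norm_nonneg v
      have hk := K.2
      nlinarith [mul_le_mul_of_nonneg_right hshort (by positivity : (0 : ℝ) ≤ ‖v‖ + 1),
        mul_nonneg hk (sub_nonneg.2 hab)]
  simpa using hpl.exists_eq_forall_mem_Icc_hasDerivWithinAt₀

variable {E : Type*} [NormedAddCommGroup E] [NormedSpace ℝ E] [FiniteDimensional ℝ E]
variable {M : Type*} [TopologicalSpace M] [ChartedSpace E M] [IsManifold 𝓘(ℝ, E) ∞ M]
variable {N : Type*} [TopologicalSpace N] [ChartedSpace E N] [IsManifold 𝓘(ℝ, E) ∞ N]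

/-! ### The metric and its Koszul form in charts -/

theorem mdifferentiable_chart {e : OpenPartialHomeomorph M E} (he : e ∈ atlas E M) :
    e.MDifferentiable 𝓘(ℝ, E) 𝓘(ℝ, E) := by
  have : IsManifold 𝓘(ℝ, E) 1 M := IsManifold.of_le (n := ∞) (by simp)
  exact mdifferentiable_of_mem_atlas he

theorem contMDiffOn_chart' {e : OpenPartialHomeomorph M E} (he : e ∈ atlas E M) :
    ContMDiffOn 𝓘(ℝ, E) 𝓘(ℝ, E) ∞ e e.source :=
  contMDiffOn_of_mem_maximalAtlas (IsManifold.subset_maximalAtlas he)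

theorem contMDiffOn_chart_symm' {e : OpenPartialHomeomorph M E} (he : e ∈ atlas E M) :
    ContMDiffOn 𝓘(ℝ, E) 𝓘(ℝ, E) ∞ e.symm e.target :=
  contMDiffOn_symm_of_mem_maximalAtlas (IsManifold.subset_maximalAtlas he)

/-- The differential of the inverse of a chart, as an endomorphism of the model space. -/
def symmDeriv (e : OpenPartialHomeomorph M E) (y : E) : E →L[ℝ] E :=
  mfderiv 𝓘(ℝ, E) 𝓘(ℝ, E) e.symm y

theorem symmDeriv_coordVec {e : OpenPartialHomeomorph M E} (he : e ∈ atlas E M)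
    (ξ : TangentBundle 𝓘(ℝ, E) M) (hξ : ξ.proj ∈ e.source) :
    symmDeriv e (e ξ.proj) (coordVec e ξ) = (ξ.2 : E) :=
  DFunLike.congr_fun ((mdifferentiable_chart he).symm_comp_deriv hξ) ξ.2

theorem coordVec_symmDeriv {e : OpenPartialHomeomorph M E} (he : e ∈ atlas E M)
    {y : E} (hy : y ∈ e.target) (v : E) :
    coordVec e ⟨e.symm y, symmDeriv e y v⟩ = v := by
  exact DFunLike.congr_fun ((mdifferentiable_chart he).symm.symm_comp_deriv
    (x := y) (by simpa using hy)) v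

theorem coordMetric_apply (g : SemiRiemannianMetric E M) (e : OpenPartialHomeomorph M E)
    (y u v : E) : coordMetric g e y u v = g.inner (e.symm y)
      (symmDeriv e y u) (symmDeriv e y v) := rfl

theorem coordMetric_comm (g : SemiRiemannianMetric E M) (e : OpenPartialHomeomorph M E)
    (y u v : E) : coordMetric g e y u v = coordMetric g e y v u := by
  rw [coordMetric_apply, coordMetric_apply]
  exact g.symm _ _ _

theorem coordMetric_coordVec (g : SemiRiemannianMetric E M) {e : OpenPartialHomeomorph M E}
    (he : e ∈ atlas E M) {x : M} (hx : x ∈ e.source) (v w : TangentSpace 𝓘(ℝ, E) x) :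
    coordMetric g e (e x) (coordVec e ⟨x, v⟩) (coordVec e ⟨x, w⟩) = g.inner x v w := by
  have hv := symmDeriv_coordVec he ⟨x, v⟩ hx
  have hw := symmDeriv_coordVec he ⟨x, w⟩ hx
  -- The points `e.symm (e x)` and `x` are only propositionally equal; a free base point `z` allows
  -- substitution.
  have key : ∀ (z : M), z = x → ∀ v' w' : E, v' = v → w' = w →
      (g.inner z : E →L[ℝ] E →L[ℝ] ℝ) v' w' = g.inner x v w := by
    rintro z rfl v' w' rfl rfl
    rfl
  exact key _ (e.left_inv hx) _ _ hv hw

/-- Each matrix entry is the smooth section `g.inner` evaluated on two coordinate fields, and these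
are smooth as tangent maps of `e.symm` applied to constant fields. -/
theorem contDiffOn_coordMetric (g : SemiRiemannianMetric E M) {e : OpenPartialHomeomorph M E}
    (he : e ∈ atlas E M) : ContDiffOn ℝ ∞ (coordMetric g e) e.target := by
  rw [contDiffOn_clm_apply]
  intro u
  rw [contDiffOn_clm_apply]
  intro v
  have hsymm := contMDiffOn_chart_symm' (E := E) he
  have hfield : ∀ u : E, ContMDiffOn 𝓘(ℝ, E) (𝓘(ℝ, E).prod 𝓘(ℝ, E)) ∞
      (fun y ↦ Bundle.TotalSpace.mk' E (E := fun x : M ↦ TangentSpace 𝓘(ℝ, E) x) (e.symm y)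
        (mfderiv 𝓘(ℝ, E) 𝓘(ℝ, E) e.symm y u)) e.target := by
    intro u
    have h1 := hsymm.contMDiffOn_tangentMapWithin (m := ∞) (by simp) e.open_target.uniqueMDiffOn
    have h2 : ContMDiffOn 𝓘(ℝ, E) (𝓘(ℝ, E).prod 𝓘(ℝ, E)) ∞
        (fun y : E ↦ (⟨y, u⟩ : TangentBundle 𝓘(ℝ, E) E)) e.target := by
      intro y _
      exact contMDiffWithinAt_vectorSpace_iff_contDiffWithinAt.2 contDiffWithinAt_const
    refine (h1.comp h2 (fun y hy ↦ hy)).congr fun y hy ↦ ?_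
    simp only [Function.comp, tangentMapWithin]
    rw [mfderivWithin_of_isOpen e.open_target hy]
  have hg : ContMDiffOn 𝓘(ℝ, E) (𝓘(ℝ, E).prod 𝓘(ℝ, E →L[ℝ] E →L[ℝ] ℝ)) ∞
      (fun y ↦ Bundle.TotalSpace.mk' (E →L[ℝ] E →L[ℝ] ℝ)
        (E := fun x : M ↦ TangentSpace 𝓘(ℝ, E) x →L[ℝ] TangentSpace 𝓘(ℝ, E) x →L[ℝ] ℝ)
        (e.symm y) (g.inner (e.symm y))) e.target :=
    g.contMDiff.comp_contMDiffOn hsymm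
  have := ContMDiffOn.clm_bundle_apply₂ (F₁ := E) (F₂ := E) (F₃ := ℝ)
    (E₁ := fun x : M ↦ TangentSpace 𝓘(ℝ, E) x) (E₂ := fun x : M ↦ TangentSpace 𝓘(ℝ, E) x)
    (E₃ := Bundle.Trivial M ℝ) hg (hfield u) (hfield v)
  rw [← contMDiffOn_iff_contDiffOn]
  intro y hy
  have h3 := this y hy
  rw [Bundle.contMDiffWithinAt_totalSpace] at h3
  exact h3.2

/-- An injective linear map from `E` to its dual is bijective by equality of dimensions. -/
theorem isInvertible_of_nondegenerate (B : E →L[ℝ] E →L[ℝ] ℝ)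
    (h : ∀ v, (∀ w, B v w = 0) → v = 0) : B.IsInvertible := by
  have hinj : Function.Injective B := by
    rw [injective_iff_map_eq_zero]
    exact fun v hv ↦ h v fun w ↦ by rw [hv]; rfl
  have hfr : Module.finrank ℝ E = Module.finrank ℝ (E →L[ℝ] ℝ) := by
    rw [← (LinearMap.toContinuousLinearMap (𝕜 := ℝ) (E := E) (F' := ℝ)).finrank_eq]
    exact (Subspace.dual_finrank_eq).symm
  exact ⟨(LinearEquiv.ofInjectiveOfFinrankEq (B : E →ₗ[ℝ] E →L[ℝ] ℝ) hinj hfr).toContinuousLinearEquiv, by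
    ext; rfl⟩

theorem coordMetric_nondegenerate (g : SemiRiemannianMetric E M) {e : OpenPartialHomeomorph M E}
    (he : e ∈ atlas E M) {y : E} (hy : y ∈ e.target) (v : E)
    (hv : ∀ w, coordMetric g e y v w = 0) : v = 0 := by
  have h0 : symmDeriv e y v = 0 := by
    refine g.nondegenerate (e.symm y) _ fun w ↦ ?_
    have hw := hv (coordVec e ⟨e.symm y, w⟩)
    have := symmDeriv_coordVec he ⟨e.symm y, w⟩ (e.map_target hy)
    rw [coordMetric_apply] at hw
    rw [e.right_inv hy] at this
    rw [← hw]
    congr 1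
    exact this.symm
  have h1 := coordVec_symmDeriv he hy v
  rw [h0] at h1
  rw [← h1]
  exact map_zero (mfderiv 𝓘(ℝ, E) 𝓘(ℝ, E) e (e.symm y))

theorem isInvertible_coordMetric (g : SemiRiemannianMetric E M) {e : OpenPartialHomeomorph M E}
    (he : e ∈ atlas E M) {y : E} (hy : y ∈ e.target) : (coordMetric g e y).IsInvertible :=
  isInvertible_of_nondegenerate _ (coordMetric_nondegenerate g he hy)

theorem koszulForm_apply (g : SemiRiemannianMetric E M) (e : OpenPartialHomeomorph M E)
    (y u v w : E) : koszulForm g e y u v w =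
      (1 / 2) * (fderiv ℝ (coordMetric g e) y u v w + fderiv ℝ (coordMetric g e) y v u w
        - fderiv ℝ (coordMetric g e) y w u v) := rfl

/-- The only access to `christoffel` used below: inside the chart's target the metric is invertible,
so `ContinuousLinearMap.inverse` is a true inverse and not the default value. -/
theorem coordMetric_christoffel (g : SemiRiemannianMetric E M) {e : OpenPartialHomeomorph M E}
    (he : e ∈ atlas E M) {y : E} (hy : y ∈ e.target) (u v w : E) :
    coordMetric g e y (christoffel g e y u v) w = koszulForm g e y u v w := by
  have h := isInvertible_coordMetric g he hy
  rw [christoffel, h.self_apply_inverse]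

theorem differentiableAt_coordMetric (g : SemiRiemannianMetric E M)
    {e : OpenPartialHomeomorph M E} (he : e ∈ atlas E M) {y : E} (hy : y ∈ e.target) :
    DifferentiableAt ℝ (coordMetric g e) y :=
  ((contDiffOn_coordMetric g he).contDiffAt (e.open_target.mem_nhds hy)).differentiableAt (by simp)

theorem fderiv_coordMetric_comm (g : SemiRiemannianMetric E M)
    {e : OpenPartialHomeomorph M E} (he : e ∈ atlas E M) {y : E} (hy : y ∈ e.target) (u v w : E) :
    fderiv ℝ (coordMetric g e) y u v w = fderiv ℝ (coordMetric g e) y u w v := by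
  have hd := (differentiableAt_coordMetric g he hy).hasFDerivAt
  have h1 := (hd.clm_apply (hasFDerivAt_const v y)).clm_apply (hasFDerivAt_const w y)
  have h2 := (hd.clm_apply (hasFDerivAt_const w y)).clm_apply (hasFDerivAt_const v y)
  have h3 := h1.unique (h2.congr_of_eventuallyEq (.of_forall fun z ↦ coordMetric_comm g e z v w))
  simpa using DFunLike.congr_fun h3 u

/-- The Levi-Civita connection is metric. -/
theorem koszulForm_add_koszulForm (g : SemiRiemannianMetric E M)
    {e : OpenPartialHomeomorph M E} (he : e ∈ atlas E M) {y : E} (hy : y ∈ e.target) (u v w : E) :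
    koszulForm g e y u v w + koszulForm g e y u w v = fderiv ℝ (coordMetric g e) y u v w := by
  rw [koszulForm_apply, koszulForm_apply, fderiv_coordMetric_comm g he hy u w v,
    fderiv_coordMetric_comm g he hy v u w, fderiv_coordMetric_comm g he hy w u v]
  ring

/-! ### Christoffel maps under metric-preserving maps -/

theorem two_le_smooth : (2 : WithTop ℕ∞) ≤ ∞ := by
  exact ENat.LEInfty.out

theorem tangentBundle_ext {ξ η : TangentBundle 𝓘(ℝ, E) M} (hp : ξ.proj = η.proj)
    (hv : (ξ.2 : E) = (η.2 : E)) : ξ = η := by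
  obtain ⟨x, v⟩ := ξ
  obtain ⟨y, w⟩ := η
  obtain rfl : x = y := hp
  exact congrArg _ hv

/-- The coordinate expression of the map `f` in the charts `e` and `e'`. -/
def coordMap (f : M → N) (e : OpenPartialHomeomorph M E) (e' : OpenPartialHomeomorph N E) :
    E → E := fun y ↦ e' (f (e.symm y))

/-- The domain of the coordinate expression of `f`. -/
def coordDomain (f : M → N) (e : OpenPartialHomeomorph M E) (e' : OpenPartialHomeomorph N E) :
    Set E := e.target ∩ e.symm ⁻¹' (f ⁻¹' e'.source)

section

variable {f : M → N} (hf : ContMDiff 𝓘(ℝ, E) 𝓘(ℝ, E) ∞ f)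
  {e : OpenPartialHomeomorph M E} (he : e ∈ atlas E M)
  {e' : OpenPartialHomeomorph N E} (he' : e' ∈ atlas E N)

include hf in
theorem isOpen_coordDomain : IsOpen (coordDomain f e e') :=
  e.isOpen_inter_preimage_symm (e'.open_source.preimage hf.continuous)

include hf he he' in
theorem contDiffOn_coordMap : ContDiffOn ℝ ∞ (coordMap f e e') (coordDomain f e e') := by
  rw [← contMDiffOn_iff_contDiffOn]
  exact (contMDiffOn_chart' he').comp (hf.comp_contMDiffOn
    ((contMDiffOn_chart_symm' he).mono inter_subset_left)) (fun y hy ↦ hy.2)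

include hf he he' in
theorem fderiv_coordMap {y : E} (hy : y ∈ coordDomain f e e') (u : E) :
    fderiv ℝ (coordMap f e e') y u = coordVec e'
      (tangentMap 𝓘(ℝ, E) 𝓘(ℝ, E) f ⟨e.symm y, symmDeriv e y u⟩) := by
  have h1 : MDifferentiableAt 𝓘(ℝ, E) 𝓘(ℝ, E) e.symm y :=
    (mdifferentiable_chart he).mdifferentiableAt_symm hy.1
  have h2 : MDifferentiableAt 𝓘(ℝ, E) 𝓘(ℝ, E) f (e.symm y) :=
    hf.mdifferentiableAt (by simp)
  have h3 : MDifferentiableAt 𝓘(ℝ, E) 𝓘(ℝ, E) e' (f (e.symm y)) :=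
    (mdifferentiable_chart he').mdifferentiableAt hy.2
  have h4 := mfderiv_comp y h3 (h2.comp y h1)
  rw [mfderiv_comp y h2 h1] at h4
  rw [← mfderiv_eq_fderiv]
  exact DFunLike.congr_fun h4 u

include hf he he' in
theorem coordVec_tangentMap (ξ : TangentBundle 𝓘(ℝ, E) M) (hξ : ξ.proj ∈ e.source)
    (hξ' : f ξ.proj ∈ e'.source) :
    coordVec e' (tangentMap 𝓘(ℝ, E) 𝓘(ℝ, E) f ξ)
      = fderiv ℝ (coordMap f e e') (e ξ.proj) (coordVec e ξ) := by
  have hy : e ξ.proj ∈ coordDomain f e e' := ⟨e.map_source hξ, by simpa [e.left_inv hξ] using hξ'⟩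
  rw [fderiv_coordMap hf he he' hy]
  congr 2
  exact (tangentBundle_ext (e.left_inv hξ) (symmDeriv_coordVec he ξ hξ)).symm

include hf he he' in
theorem coordMetric_coordMap {g : SemiRiemannianMetric E M} {h : SemiRiemannianMetric E N}
    (hfg : PreservesMetric g h f) {y : E} (hy : y ∈ coordDomain f e e') (u v : E) :
    coordMetric g e y u v = coordMetric h e' (coordMap f e e' y)
      (fderiv ℝ (coordMap f e e') y u) (fderiv ℝ (coordMap f e e') y v) := by
  rw [fderiv_coordMap hf he he' hy, fderiv_coordMap hf he he' hy]
  refine Eq.trans ?_ (coordMetric_coordVec h he' (x := f (e.symm y)) hy.2 _ _).symm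
  rw [coordMetric_apply]
  exact (hfg _ _ _).symm

end

/-- The derivative of the pullback of a field of bilinear forms. -/
theorem fderiv_bilinear_pullback {G G' : E → E →L[ℝ] E →L[ℝ] ℝ} {φ : E → E} {y : E}
    (hG : DifferentiableAt ℝ G y) (hG' : DifferentiableAt ℝ G' (φ y))
    (hφ : DifferentiableAt ℝ φ y) (hφ' : DifferentiableAt ℝ (fderiv ℝ φ) y)
    (heq : ∀ᶠ z in 𝓝 y, ∀ v w, G z v w = G' (φ z) (fderiv ℝ φ z v) (fderiv ℝ φ z w))
    (u v w : E) : fderiv ℝ G y u v w =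
      fderiv ℝ G' (φ y) (fderiv ℝ φ y u) (fderiv ℝ φ y v) (fderiv ℝ φ y w)
      + G' (φ y) (fderiv ℝ (fderiv ℝ φ) y u v) (fderiv ℝ φ y w)
      + G' (φ y) (fderiv ℝ φ y v) (fderiv ℝ (fderiv ℝ φ) y u w) := by
  have h1 := (hG.hasFDerivAt.clm_apply (hasFDerivAt_const v y)).clm_apply (hasFDerivAt_const w y)
  have hv := hφ'.hasFDerivAt.clm_apply (hasFDerivAt_const v y)
  have hw := hφ'.hasFDerivAt.clm_apply (hasFDerivAt_const w y)
  have hc : HasFDerivAt (fun z ↦ G' (φ z)) ((fderiv ℝ G' (φ y)).comp (fderiv ℝ φ y)) y :=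
    HasFDerivAt.comp (G := E →L[ℝ] E →L[ℝ] ℝ) (g := G') y hG'.hasFDerivAt hφ.hasFDerivAt
  have h2 := (hc.clm_apply hv).clm_apply hw
  have h3 := h1.unique (h2.congr_of_eventuallyEq (heq.mono fun z hz ↦ hz v w))
  have h4 := DFunLike.congr_fun h3 u
  simp at h4
  rw [h4]
  ring

/-- The Christoffel maps transform under isometries (and in particular under a change of charts)
by adding the second derivative of the coordinate expression. -/
theorem christoffel_coordMap {f : M → N} (hf : ContMDiff 𝓘(ℝ, E) 𝓘(ℝ, E) ∞ f)
    {e : OpenPartialHomeomorph M E} (he : e ∈ atlas E M)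
    {e' : OpenPartialHomeomorph N E} (he' : e' ∈ atlas E N)
    {g : SemiRiemannianMetric E M} {h : SemiRiemannianMetric E N}
    (hfg : PreservesMetric g h f) {y : E} (hy : y ∈ coordDomain f e e') (u v : E) :
    fderiv ℝ (coordMap f e e') y (christoffel g e y u v)
      = christoffel h e' (coordMap f e e' y) (fderiv ℝ (coordMap f e e') y u)
          (fderiv ℝ (coordMap f e e') y v)
        + fderiv ℝ (fderiv ℝ (coordMap f e e')) y u v := by
  set φ := coordMap f e e' with hφdef
  have hopen := isOpen_coordDomain (e := e) (e' := e') hf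
  have hφ : ContDiffAt ℝ ∞ φ y := (contDiffOn_coordMap hf he he').contDiffAt (hopen.mem_nhds hy)
  have hφy : φ y ∈ e'.target := e'.map_source hy.2
  have hφ1 : DifferentiableAt ℝ φ y := hφ.differentiableAt (by simp)
  have hφ2 : ContDiffAt ℝ 1 (fderiv ℝ φ) y := hφ.fderiv_right (m := 1) (one_add_one_eq_two.trans_le two_le_smooth)
  have hφ2' : DifferentiableAt ℝ (fderiv ℝ φ) y := hφ2.differentiableAt (by simp)
  have hpull : ∀ᶠ z in 𝓝 y, ∀ v w, coordMetric g e z v w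
      = coordMetric h e' (φ z) (fderiv ℝ φ z v) (fderiv ℝ φ z w) := by
    filter_upwards [hopen.mem_nhds hy] with z hz v w
    exact coordMetric_coordMap hf he he' hfg hz v w
  have hsym : ∀ a b, fderiv ℝ (fderiv ℝ φ) y a b = fderiv ℝ (fderiv ℝ φ) y b a := by
    have := hφ.isSymmSndFDerivAt (by simpa using two_le_smooth)
    exact fun a b ↦ this.eq a b
  have hder := fderiv_bilinear_pullback (differentiableAt_coordMetric g he hy.1)
    (differentiableAt_coordMetric h he' hφy) hφ1 hφ2' hpull
  -- A kernel vector of the differential would be orthogonal to everything. In finite dimension the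
  -- differential is then onto, so it suffices to test against vectors in its image.
  have hinj : Function.Injective (fderiv ℝ φ y) := by
    rw [injective_iff_map_eq_zero]
    intro a ha
    refine coordMetric_nondegenerate g he hy.1 a fun w ↦ ?_
    rw [hpull.self_of_nhds, ha, map_zero]
    rfl
  have hsurj : Function.Surjective (fderiv ℝ φ y) :=
    (LinearMap.injective_iff_surjective (f := (fderiv ℝ φ y : E →ₗ[ℝ] E))).1 hinj
  rw [← sub_eq_zero]
  refine coordMetric_nondegenerate h he' hφy _ fun w' ↦ ?_
  obtain ⟨w, rfl⟩ := hsurj w'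
  -- Each of the three derivatives in the Koszul formula contributes two second-derivative terms. By
  -- symmetry of the second derivative and of the metric, four of them cancel and two add up to the
  -- claimed correction.
  rw [map_sub, map_add, sub_apply, add_apply, ← hpull.self_of_nhds, coordMetric_christoffel g he hy.1,
    coordMetric_christoffel h he' hφy, koszulForm_apply, koszulForm_apply, hder, hder, hder,
    hsym w u, hsym w v, hsym v u,
    coordMetric_comm h e' (φ y) (fderiv ℝ φ y v) (fderiv ℝ (fderiv ℝ φ) y u w),
    coordMetric_comm h e' (φ y) (fderiv ℝ φ y u) (fderiv ℝ (fderiv ℝ φ) y v w)]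
  ring

/-! ### Parallel fields: naturality and constancy of scalar products -/

/-- `X` satisfies the equation of parallel fields along `c` at the time `t` in the chart `e`. -/
def IsParallelAt (g : SemiRiemannianMetric E M) (e : OpenPartialHomeomorph M E) (c : ℝ → M)
    (X : ℝ → TangentBundle 𝓘(ℝ, E) M) (s : Set ℝ) (t : ℝ) : Prop :=
  ∃ u : E, HasDerivWithinAt (fun s ↦ e (c s)) u s t ∧
    HasDerivWithinAt (fun s ↦ coordVec e (X s))
      (-christoffel g e (e (c t)) u (coordVec e (X t))) s t

/-- Smooth maps that preserve the metrics carry parallel fields to parallel fields. -/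
theorem IsParallelAt.map {f : M → N} (hf : ContMDiff 𝓘(ℝ, E) 𝓘(ℝ, E) ∞ f)
    {g : SemiRiemannianMetric E M} {h : SemiRiemannianMetric E N} (hfg : PreservesMetric g h f)
    {e : OpenPartialHomeomorph M E} (he : e ∈ atlas E M)
    {e' : OpenPartialHomeomorph N E} (he' : e' ∈ atlas E N)
    {c : ℝ → M} {X : ℝ → TangentBundle 𝓘(ℝ, E) M} {s : Set ℝ} {t : ℝ} (ht : t ∈ s)
    (hX : ∀ r ∈ s, (X r).proj = c r) (hc : ContinuousWithinAt c s t)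
    (hce : c t ∈ e.source) (hce' : f (c t) ∈ e'.source) (hpar : IsParallelAt g e c X s t) :
    IsParallelAt h e' (f ∘ c) (fun r ↦ tangentMap 𝓘(ℝ, E) 𝓘(ℝ, E) f (X r)) s t := by
  obtain ⟨u, hu, hV⟩ := hpar
  set φ := coordMap f e e' with hφdef
  have hy : e (c t) ∈ coordDomain f e e' := ⟨e.map_source hce, by simpa [e.left_inv hce] using hce'⟩
  have hopen := isOpen_coordDomain (e := e) (e' := e') hf
  have hφ : ContDiffAt ℝ ∞ φ (e (c t)) :=
    (contDiffOn_coordMap hf he he').contDiffAt (hopen.mem_nhds hy)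
  have hφ1 : DifferentiableAt ℝ φ (e (c t)) := hφ.differentiableAt (by simp)
  have hφ2 : ContDiffAt ℝ 1 (fderiv ℝ φ) (e (c t)) :=
    hφ.fderiv_right (m := 1) (one_add_one_eq_two.trans_le two_le_smooth)
  have hφ2' : DifferentiableAt ℝ (fderiv ℝ φ) (e (c t)) := hφ2.differentiableAt (by simp)
  have hev1 : ∀ᶠ r in 𝓝[s] t, c r ∈ e.source := hc (e.open_source.mem_nhds hce)
  have hev2 : ∀ᶠ r in 𝓝[s] t, f (c r) ∈ e'.source :=
    hc ((e'.open_source.preimage hf.continuous).mem_nhds hce')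
  have hmap : ∀ r ∈ s, c r ∈ e.source → f (c r) ∈ e'.source →
      coordVec e' (tangentMap 𝓘(ℝ, E) 𝓘(ℝ, E) f (X r))
        = fderiv ℝ φ (e (c r)) (coordVec e (X r)) := fun r hr h1 h2 ↦ by
    rw [← hX r hr] at h1 h2 ⊢
    exact coordVec_tangentMap hf he he' (X r) h1 h2
  have hbase : ∀ r, c r ∈ e.source → e' (f (c r)) = φ (e (c r)) := fun r h1 ↦ by
    simp only [hφdef, coordMap, e.left_inv h1]
  refine ⟨fderiv ℝ φ (e (c t)) u, ?_, ?_⟩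
  · have h1 : HasDerivWithinAt (fun r ↦ φ (e (c r))) (fderiv ℝ φ (e (c t)) u) s t :=
      HasFDerivAt.comp_hasDerivWithinAt (l := φ) t hφ1.hasFDerivAt hu
    exact h1.congr_of_eventuallyEq (hev1.mono fun r hr ↦ hbase r hr) (hbase t hce)
  · have h1 : HasDerivWithinAt (fun r ↦ fderiv ℝ φ (e (c r)))
        (fderiv ℝ (fderiv ℝ φ) (e (c t)) u) s t :=
      hφ2'.hasFDerivAt.comp_hasDerivWithinAt t hu
    have h2 := (h1.clm_apply hV).congr_of_eventuallyEq
      (f₁ := fun r ↦ coordVec e' (tangentMap 𝓘(ℝ, E) 𝓘(ℝ, E) f (X r)))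
      (by filter_upwards [hev1, hev2, self_mem_nhdsWithin] with r h1 h2 h3 using hmap r h3 h1 h2)
      (hmap t ht hce hce')
    -- The product rule yields the second derivative of `φ` at `u` and the field, which is precisely
    -- the defect in `christoffel_coordMap`.
    convert h2 using 1
    simp only [Function.comp]
    rw [hmap t ht hce hce', hbase t hce, map_neg, christoffel_coordMap hf he he' hfg hy]
    abel

theorem preservesMetric_id (g : SemiRiemannianMetric E M) : PreservesMetric g g id := fun x v w ↦ by
  rw [mfderiv_id]
  rfl

/-- A change of charts is the coordinate expression of the identity, which preserves the metric;
hence one chart at each time suffices. -/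
theorem isParallelOn_of_chart {g : SemiRiemannianMetric E M} {c : ℝ → M}
    {X : ℝ → TangentBundle 𝓘(ℝ, E) M} {a b : ℝ} (hX : ∀ r ∈ Icc a b, (X r).proj = c r)
    (hc : ContinuousOn c (Icc a b))
    (h : ∀ t ∈ Icc a b, ∃ e ∈ atlas E M, c t ∈ e.source ∧ IsParallelAt g e c X (Icc a b) t) :
    IsParallelOn g c X a b := by
  intro t ht e' he' hce'
  obtain ⟨e, he, hce, hpar⟩ := h t ht
  have := hpar.map contMDiff_id (preservesMetric_id g) he he' ht hX (hc t ht) hce hce'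
  simpa only [tangentMap_id, Function.id_comp] using! this

theorem IsParallelOn.map {f : M → N} (hf : ContMDiff 𝓘(ℝ, E) 𝓘(ℝ, E) ∞ f)
    {g : SemiRiemannianMetric E M} {h : SemiRiemannianMetric E N} (hfg : PreservesMetric g h f)
    {c : ℝ → M} {X : ℝ → TangentBundle 𝓘(ℝ, E) M} {a b : ℝ}
    (hX : ∀ r ∈ Icc a b, (X r).proj = c r) (hc : ContinuousOn c (Icc a b))
    (hpar : IsParallelOn g c X a b) :
    IsParallelOn h (f ∘ c) (fun r ↦ tangentMap 𝓘(ℝ, E) 𝓘(ℝ, E) f (X r)) a b := by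
  intro t ht e' he' hce'
  exact IsParallelAt.map hf hfg (chart_mem_atlas E (c t)) he' ht hX (hc t ht)
    (mem_chart_source E (c t)) hce' (hpar t ht _ (chart_mem_atlas E (c t)) (mem_chart_source E _))

/-- The scalar product of parallel fields is constant. -/
theorem IsParallelOn.inner_eq {g : SemiRiemannianMetric E M} {c : ℝ → M}
    {X Y : ℝ → TangentBundle 𝓘(ℝ, E) M} {a b : ℝ} (hab : a ≤ b)
    (hc : ContinuousOn c (Icc a b)) (hX : IsParallelOn g c X a b) (hY : IsParallelOn g c Y a b)
    (hXc : ∀ r ∈ Icc a b, (X r).proj = c r) (hYc : ∀ r ∈ Icc a b, (Y r).proj = c r) :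
    (g.inner (c a) : E →L[ℝ] E →L[ℝ] ℝ) (X a).2 (Y a).2
      = (g.inner (c b) : E →L[ℝ] E →L[ℝ] ℝ) (X b).2 (Y b).2 := by
  rcases hab.eq_or_lt with rfl | hab'
  · rfl
  let F : ℝ → ℝ := fun t ↦ (g.inner (c t) : E →L[ℝ] E →L[ℝ] ℝ) (X t).2 (Y t).2
  have hF : ∀ t ∈ Icc a b, HasDerivWithinAt F 0 (Icc a b) t := by
    intro t ht
    set e := chartAt E (c t)
    have he : e ∈ atlas E M := chart_mem_atlas E (c t)
    have hce : c t ∈ e.source := mem_chart_source E (c t)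
    have hy := e.map_source hce
    obtain ⟨u, hu, hV⟩ := hX t ht e he hce
    obtain ⟨u', hu', hW⟩ := hY t ht e he hce
    have hval : ∀ r ∈ Icc a b, c r ∈ e.source →
        F r = coordMetric g e (e (c r)) (coordVec e (X r)) (coordVec e (Y r)) := by
      intro r hr hre
      have hx : X r = ⟨c r, ((X r).2 : E)⟩ := tangentBundle_ext (hXc r hr) rfl
      have hy : Y r = ⟨c r, ((Y r).2 : E)⟩ := tangentBundle_ext (hYc r hr) rfl
      have := coordMetric_coordVec g he hre ((X r).2 : E) ((Y r).2 : E)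
      rw [hx, hy]
      simp only [F]
      exact this.symm
    -- Both parallel equations involve the velocity of the same coordinate curve, and derivatives
    -- within a nondegenerate interval are unique.
    obtain rfl : u = u' := (uniqueDiffOn_Icc hab' t ht).eq_deriv _ hu hu'
    have h1 : HasDerivWithinAt (fun r ↦ coordMetric g e (e (c r)))
        (fderiv ℝ (coordMetric g e) (e (c t)) u) (Icc a b) t :=
      HasFDerivAt.comp_hasDerivWithinAt (E := E →L[ℝ] E →L[ℝ] ℝ) (l := coordMetric g e) t
        (differentiableAt_coordMetric g he hy).hasFDerivAt hu
    have h2 := ((h1.clm_apply hV).clm_apply hW).congr_of_eventuallyEq (f₁ := F)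
      (by filter_upwards [hc t ht (e.open_source.mem_nhds hce), self_mem_nhdsWithin] with r h1 h2
            using hval r h2 h1) (hval t ht hce)
    refine h2.congr_deriv ?_
    simp only [map_neg, neg_apply, add_apply]
    -- Metricity of the connection: the derivative of the metric coefficients cancels the two
    -- Christoffel terms.
    rw [coordMetric_comm g e _ (coordVec e (X t)), coordMetric_christoffel g he hy,
      coordMetric_christoffel g he hy, ← koszulForm_add_koszulForm g he hy]
    ring
  have := constant_of_has_deriv_right_zero (f := F) (a := a) (b := b)
    (fun t ht ↦ (hF t ht).continuousWithinAt)
    (fun t ht ↦ ((hF t ⟨ht.1, ht.2.le⟩).mono_of_mem_nhdsWithin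
      (Icc_mem_nhdsGE_of_mem ht)))
  exact (this b (right_mem_Icc.2 hab)).symm

/-! ### Existence of parallel fields -/

/-- A transitive relation on a compact interval that holds for the end points of each subinterval
without interior points in a finite set holds for the end points. -/
theorem relation_Icc_of_finite {a b : ℝ} (hab : a ≤ b) (P : ℝ → ℝ → Prop) {S : Set ℝ}
    (hS : S.Finite) (refl : ∀ r, P r r)
    (trans : ∀ r s t, a ≤ r → r ≤ s → s ≤ t → t ≤ b → P r s → P s t → P r t)
    (piece : ∀ r s, a ≤ r → r < s → s ≤ b → Disjoint (Ioo r s) S → P r s) : P a b := by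
  refine relation_Icc_of_locally hab P trans fun t _ ↦ ?_
  obtain ⟨ε, hε, hgap⟩ := exists_gap hS t
  have hpiece : ∀ r s, a ≤ r → r ≤ s → s ≤ b → |r - t| < ε → |s - t| < ε → t ∉ Ioo r s →
      P r s := by
    intro r s hr hrs hs hrt hst hts
    rcases hrs.eq_or_lt with rfl | hlt
    · exact refl r
    · refine piece r s hr hlt hs (Set.disjoint_left.2 fun x hx hxS ↦ hts ?_)
      rw [← hgap x hxS (by rw [abs_lt] at *; constructor <;> linarith [hx.1, hx.2])]
      exact hx
  refine ⟨ε, hε, fun r s hr hrs hs hrt hst ↦ ?_⟩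
  -- Near `t` the only possible break point is `t` itself, so cutting there leaves two pieces
  -- without break points.
  by_cases hts : t ∈ Ioo r s
  · have htt : |t - t| < ε := by simpa using hε
    exact trans r t s hr hts.1.le hts.2.le hs
      (hpiece r t hr hts.1.le (hts.2.le.trans hs) hrt htt fun h ↦ h.2.false)
      (hpiece t s (hr.trans hts.1.le) hts.2.le hs htt hst fun h ↦ h.1.false)
  · exact hpiece r s hr hrs hs hrt hst hts

theorem IsParallelOn.congr {g : SemiRiemannianMetric E M} {c : ℝ → M}
    {X X' : ℝ → TangentBundle 𝓘(ℝ, E) M} {a b a' b' : ℝ} (h : IsParallelOn g c X a b)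
    (hsub : Icc a' b' ⊆ Icc a b) (hX : ∀ s ∈ Icc a' b', X' s = X s) :
    IsParallelOn g c X' a' b' :=
  h.comp_affine (k := 1) (d := 0) (fun s hs ↦ by simpa using hsub hs) (fun s _ ↦ by simp)
    (fun s hs ↦ by simpa using hX s hs)

/-- The Koszul form as a linear map of the differentiated vector field. -/
def koszulMap (g : SemiRiemannianMetric E M) (e : OpenPartialHomeomorph M E) (y u : E) :
    E →L[ℝ] E →L[ℝ] ℝ :=
  (1 / 2 : ℝ) • (fderiv ℝ (coordMetric g e) y u + (fderiv ℝ (coordMetric g e) y).flip u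
    - ((fderiv ℝ (coordMetric g e) y).flip u).flip)

/-- The Christoffel map as a linear map of the differentiated vector field. -/
def christoffelMap (g : SemiRiemannianMetric E M) (e : OpenPartialHomeomorph M E) (y u : E) :
    E →L[ℝ] E :=
  (ContinuousLinearMap.inverse (coordMetric g e y)).comp (koszulMap g e y u)

theorem christoffelMap_apply (g : SemiRiemannianMetric E M) (e : OpenPartialHomeomorph M E)
    (y u v : E) : christoffelMap g e y u v = christoffel g e y u v := rfl

theorem continuousWithinAt_flip {F : Type*} [NormedAddCommGroup F] [NormedSpace ℝ F]
    {B : ℝ → E →L[ℝ] E →L[ℝ] F} {s : Set ℝ} {t : ℝ} (h : ContinuousWithinAt B s t) :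
    ContinuousWithinAt (fun r ↦ (B r).flip) s t :=
  (ContinuousLinearMap.flipₗᵢ ℝ E E F).continuous.continuousAt.comp_continuousWithinAt h

-- Inversion is continuous at invertible maps, and the metric and its derivative vary continuously
-- with the base point. This provides the continuous coefficients of the parallel equation.
set_option maxSynthPendingDepth 3 in
theorem continuousWithinAt_christoffelMap (g : SemiRiemannianMetric E M)
    {e : OpenPartialHomeomorph M E} (he : e ∈ atlas E M) {y u : ℝ → E} {s : Set ℝ} {t : ℝ}
    (hy : ContinuousWithinAt y s t) (hu : ContinuousWithinAt u s t) (hyt : y t ∈ e.target) :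
    ContinuousWithinAt (fun r ↦ christoffelMap g e (y r) (u r)) s t := by
  have hG : ContDiffAt ℝ ∞ (coordMetric g e) (y t) :=
    (contDiffOn_coordMetric g he).contDiffAt (e.open_target.mem_nhds hyt)
  have hinv : ContinuousAt (ContinuousLinearMap.inverse : (E →L[ℝ] E →L[ℝ] ℝ) → _)
      (coordMetric g e (y t)) :=
    ((isInvertible_coordMetric g he hyt).contDiffAt_map_inverse (n := 0)).continuousAt
  have h1 : ContinuousWithinAt (fun r ↦ ContinuousLinearMap.inverse (coordMetric g e (y r))) s t :=
    hinv.comp_continuousWithinAt (f := fun r ↦ coordMetric g e (y r))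
      (hG.continuousAt.comp_continuousWithinAt hy)
  have hD : ContinuousWithinAt (fun r ↦ fderiv ℝ (coordMetric g e) (y r)) s t :=
    (hG.fderiv_right (m := 0) (by simp)).continuousAt.comp_continuousWithinAt hy
  have hflip : ContinuousWithinAt (fun r ↦ (fderiv ℝ (coordMetric g e) (y r)).flip) s t :=
    continuousWithinAt_flip hD
  have hflip' := hflip.clm_apply hu
  have hflip'' : ContinuousWithinAt
      (fun r ↦ ((fderiv ℝ (coordMetric g e) (y r)).flip (u r)).flip) s t :=
    continuousWithinAt_flip hflip'
  exact h1.clm_comp ((((hD.clm_apply hu).add hflip').sub hflip'').const_smul (1 / 2 : ℝ))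

/-- Local existence of parallel fields, with a uniform time of existence. -/
theorem exists_isParallelOn_locally (g : SemiRiemannianMetric E M) {c : ℝ → M} {a b : ℝ}
    (hab : a < b) (hc : ContMDiffOn 𝓘(ℝ, ℝ) 𝓘(ℝ, E) ∞ c (Icc a b)) {t : ℝ} (ht : t ∈ Icc a b) :
    ∃ ε > 0, ∀ r s, a ≤ r → r ≤ s → s ≤ b → |r - t| < ε → |s - t| < ε → ∀ v : E,
      ∃ X : ℝ → TangentBundle 𝓘(ℝ, E) M, X r = ⟨c r, v⟩ ∧ (∀ q ∈ Icc r s, (X q).proj = c q) ∧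
        IsParallelOn g c X r s := by
  set e := chartAt E (c t)
  have he : e ∈ atlas E M := chart_mem_atlas E (c t)
  have hce : c t ∈ e.source := mem_chart_source E (c t)
  let y : ℝ → E := fun r ↦ e (c r)
  let u : ℝ → E := derivWithin y (Icc a b)
  let A : ℝ → E →L[ℝ] E := fun r ↦ -christoffelMap g e (y r) (u r)
  have hy : ∀ q ∈ Icc a b, c q ∈ e.source → ContDiffWithinAt ℝ ∞ y (Icc a b) q := by
    intro q hq hqe
    rw [← contMDiffWithinAt_iff_contDiffWithinAt]
    exact ((contMDiffOn_chart' he).contMDiffAt (e.open_source.mem_nhds hqe)).comp_contMDiffWithinAt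
      q (hc q hq)
  have hu : ∀ q ∈ Icc a b, c q ∈ e.source → HasDerivWithinAt y (u q) (Icc a b) q :=
    fun q hq hqe ↦ ((hy q hq hqe).differentiableWithinAt (by simp)).hasDerivWithinAt
  have hA : ∀ q ∈ Icc a b, c q ∈ e.source → ContinuousWithinAt A (Icc a b) q := by
    intro q hq hqe
    have hu' : ContinuousWithinAt u (Icc a b) q :=
      ((hy q hq hqe).fderivWithin_right (m := 0) (uniqueDiffOn_Icc hab) (by simp)
        hq).continuousWithinAt.clm_apply continuousWithinAt_const
    exact (continuousWithinAt_christoffelMap g he (hy q hq hqe).continuousWithinAt hu'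
      (e.map_source hqe)).neg
  -- The summand `1` makes the bound strict at `t`, hence valid nearby by continuity, and makes `K`
  -- positive.
  let K : NNReal := ‖A t‖₊ + 1
  have hev : ∀ᶠ q in 𝓝[Icc a b] t, c q ∈ e.source ∧ ‖A q‖ ≤ K := by
    refine ((hc.continuousOn t ht).eventually (e.open_source.mem_nhds hce)).and ?_
    have := (hA t ht hce).norm.eventually (gt_mem_nhds (show ‖A t‖ < K by simp [K]))
    exact this.mono fun q hq ↦ hq.le
  obtain ⟨δ, hδ, hball⟩ := Metric.mem_nhdsWithin_iff.1 hev
  have hK : (0 : ℝ) < K := by simp only [K]; positivity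
  -- Within distance `1 / (4K)` of `t` an interval has length at most `1 / (2K)`, as the linear
  -- equation requires. The bound does not involve `v`, which is what permits gluing.
  refine ⟨min δ (1 / (4 * K)), by positivity, fun r s hr hrs hs hrt hst v ↦ ?_⟩
  have hsub : Icc r s ⊆ Icc a b := Icc_subset_Icc hr hs
  have hgood : ∀ q ∈ Icc r s, c q ∈ e.source ∧ ‖A q‖ ≤ K := fun q hq ↦ by
    refine hball ⟨?_, hsub hq⟩
    rw [Metric.mem_ball, Real.dist_eq]
    have h1 := hrt.trans_le (min_le_left _ _)
    have h2 := hst.trans_le (min_le_left _ _)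
    rw [abs_lt] at *
    constructor <;> linarith [hq.1, hq.2]
  have hshort : 2 * K * (s - r) ≤ 1 := by
    have h1 := hrt.trans_le (min_le_right _ _)
    have h2 := hst.trans_le (min_le_right _ _)
    have h3 : s - r ≤ 1 / (2 * K) := by
      have : 1 / (2 * (K : ℝ)) = 1 / (4 * K) + 1 / (4 * K) := by field_simp; norm_num
      rw [abs_lt] at *
      linarith
    calc 2 * K * (s - r) ≤ 2 * K * (1 / (2 * K)) := by gcongr
      _ = 1 := by field_simp
  obtain ⟨V, hV0, hV⟩ := exists_linear_ode_solution hrs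
    (fun q hq ↦ (hA q (hsub hq) (hgood q hq).1).mono hsub) (fun q hq ↦ (hgood q hq).2) hshort
    (coordVec e ⟨c r, v⟩)
  let X : ℝ → TangentBundle 𝓘(ℝ, E) M := fun q ↦ ⟨c q, symmDeriv e (y q) (V q)⟩
  have hXV : ∀ q ∈ Icc r s, coordVec e (X q) = V q := by
    intro q hq
    have hqe := (hgood q hq).1
    have h1 : X q = ⟨e.symm (y q), symmDeriv e (y q) (V q)⟩ :=
      tangentBundle_ext (e.left_inv hqe).symm rfl
    rw [h1, coordVec_symmDeriv he (e.map_source hqe)]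
  refine ⟨X, ?_, fun q _ ↦ rfl, ?_⟩
  · refine tangentBundle_ext rfl ?_
    have h1 := symmDeriv_coordVec he (⟨c r, v⟩ : TangentBundle 𝓘(ℝ, E) M)
      (hgood r (left_mem_Icc.2 hrs)).1
    rw [← hV0] at h1
    exact h1
  · refine isParallelOn_of_chart (fun q _ ↦ rfl) (hc.continuousOn.mono hsub) fun q hq ↦
      ⟨e, he, (hgood q hq).1, u q, (hu q (hsub hq) (hgood q hq).1).mono hsub, ?_⟩
    rw [hXV q hq, ← christoffelMap_apply]
    exact (hV q hq).congr hXV (hXV q hq)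

/-- `X` is piecewise parallel along `c` on the interval `[a, b]`. -/
def IsPiecewiseParallelOn (g : SemiRiemannianMetric E M) (c : ℝ → M)
    (X : ℝ → TangentBundle 𝓘(ℝ, E) M) (a b : ℝ) : Prop :=
  (∀ t ∈ Icc a b, (X t).proj = c t) ∧
  ∃ S : Set ℝ, S.Finite ∧ ∀ r s : ℝ, a ≤ r → r < s → s ≤ b → Disjoint (Ioo r s) S →
    ContMDiffOn 𝓘(ℝ, ℝ) 𝓘(ℝ, E) ∞ c (Icc r s) ∧ IsParallelOn g c X r s

theorem isParallelAlong_iff {g : SemiRiemannianMetric E M} {x y : M} {γ : Path x y}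
    {X : ℝ → TangentBundle 𝓘(ℝ, E) M} :
    IsParallelAlong g γ X ↔ IsPiecewiseParallelOn g γ.extend X 0 1 := Iff.rfl

theorem IsPiecewiseParallelOn.union {g : SemiRiemannianMetric E M} {c : ℝ → M}
    {X Y : ℝ → TangentBundle 𝓘(ℝ, E) M} {a b d : ℝ}
    (hX : IsPiecewiseParallelOn g c X a b) (hY : IsPiecewiseParallelOn g c Y b d)
    (hXY : X b = Y b) :
    IsPiecewiseParallelOn g c (fun t ↦ if t ≤ b then X t else Y t) a d := by
  obtain ⟨hXp, S, hS, hX⟩ := hX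
  obtain ⟨hYp, T, hT, hY⟩ := hY
  have hright : ∀ t, b ≤ t → (if t ≤ b then X t else Y t) = Y t := fun t ht ↦ by
    rcases ht.eq_or_lt with rfl | hlt
    · rw [if_pos le_rfl, hXY]
    · rw [if_neg (not_le.2 hlt)]
  refine ⟨fun t ht ↦ ?_, {b} ∪ (S ∪ T), (finite_singleton b).union (hS.union hT),
    fun r s hr hrs hs hdis ↦ ?_⟩
  · rcases le_total t b with h | h
    · simpa only [if_pos h] using hXp t ⟨ht.1, h⟩
    · simpa only [hright t h] using hYp t ⟨h, ht.2⟩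
  · rw [disjoint_union_right, disjoint_union_right, disjoint_singleton_right] at hdis
    obtain ⟨hb, hdS, hdT⟩ := hdis
    rcases le_or_gt s b with h | h
    · obtain ⟨h1, h2⟩ := hX r s hr hrs h hdS
      exact ⟨h1, h2.congr Subset.rfl fun t ht ↦ if_pos (ht.2.trans h)⟩
    · have h' : b ≤ r := not_lt.1 fun h' ↦ hb ⟨h', h⟩
      obtain ⟨h1, h2⟩ := hY r s h' hrs hs hdT
      exact ⟨h1, h2.congr Subset.rfl fun t ht ↦ hright t (h'.trans ht.1)⟩

/-- Each vector at the initial point extends to a piecewise parallel field on `[a, b]`. -/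
def HasParallelExtension (g : SemiRiemannianMetric E M) (c : ℝ → M) (a b : ℝ) : Prop :=
  ∀ v : E, ∃ X : ℝ → TangentBundle 𝓘(ℝ, E) M, X a = ⟨c a, v⟩ ∧ IsPiecewiseParallelOn g c X a b

theorem HasParallelExtension.refl (g : SemiRiemannianMetric E M) (c : ℝ → M) (a : ℝ) :
    HasParallelExtension g c a a := fun v ↦
  ⟨fun q ↦ ⟨c q, v⟩, rfl, fun _ _ ↦ rfl, ∅, finite_empty, fun r s hr hrs hs _ ↦ by linarith⟩

theorem HasParallelExtension.trans {g : SemiRiemannianMetric E M} {c : ℝ → M} {r s t : ℝ}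
    (hrs : r ≤ s) (_ : s ≤ t) (h1 : HasParallelExtension g c r s)
    (h2 : HasParallelExtension g c s t) : HasParallelExtension g c r t := by
  intro v
  obtain ⟨X, hX0, hX⟩ := h1 v
  obtain ⟨Y, hY0, hY⟩ := h2 (X s).2
  refine ⟨_, ?_, hX.union hY ?_⟩
  · rw [if_pos hrs, hX0]
  · rw [hY0]
    exact tangentBundle_ext (hX.1 s (right_mem_Icc.2 hrs)) rfl

/-- Extendability of every initial vector is a transitive relation between times. It holds locally
on smooth pieces, so compactness gives it on each piece and finiteness of the break points on `[0,
1]`. -/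
theorem exists_isParallelAlong (g : SemiRiemannianMetric E M) {x y : M} {γ : Path x y}
    (hγ : PiecewiseSmooth (E := E) γ) (v : E) :
    ∃ X : ℝ → TangentBundle 𝓘(ℝ, E) M, IsParallelAlong g γ X ∧ X 0 = ⟨x, v⟩ := by
  obtain ⟨S, hS, hγ⟩ := hγ
  have hmain : HasParallelExtension g γ.extend 0 1 := by
    refine relation_Icc_of_finite zero_le_one _ hS (HasParallelExtension.refl g γ.extend)
      (fun r s t _ hrs hst _ ↦ HasParallelExtension.trans hrs hst) fun a b ha hab hb hdis ↦ ?_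
    have hsm := hγ a b ha hab hb hdis
    refine relation_Icc_of_locally hab.le _
      (fun r s t _ hrs hst _ ↦ HasParallelExtension.trans hrs hst) fun t ht ↦ ?_
    obtain ⟨ε, hε, hloc⟩ := exists_isParallelOn_locally g hab hsm ht
    refine ⟨ε, hε, fun r s hr hrs hs hrt hst v ↦ ?_⟩
    obtain ⟨X, hX0, hXp, hX⟩ := hloc r s hr hrs hs hrt hst v
    exact ⟨X, hX0, hXp, ∅, finite_empty, fun r' s' hr' hrs' hs' _ ↦
      ⟨hsm.mono (Icc_subset_Icc (hr.trans hr') (hs'.trans hs)),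
        hX.congr (Icc_subset_Icc hr' hs') fun _ _ ↦ rfl⟩⟩
  obtain ⟨X, hX0, hX⟩ := hmain v
  exact ⟨X, isParallelAlong_iff.2 hX, hX0.trans (tangentBundle_ext γ.extend_zero rfl)⟩

/-! ### Existence and uniqueness of parallel transport -/

theorem IsParallelAlong.symm {g : SemiRiemannianMetric E M} {x y : M} {γ : Path x y}
    {X : ℝ → TangentBundle 𝓘(ℝ, E) M} (h : IsParallelAlong g γ X) :
    IsParallelAlong g γ.symm (fun t ↦ X (1 - t)) := by
  obtain ⟨hp, S, hS, hX⟩ := h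
  refine ⟨fun t ht ↦ ?_, (fun t ↦ 1 - t) '' S, hS.image _, fun a b ha hab hb hdis ↦ ?_⟩
  · rw [Path.extend_symm_apply]
    exact hp _ ⟨by linarith [ht.2], by linarith [ht.1]⟩
  · obtain ⟨hs, hpar⟩ := hX (1 - b) (1 - a) (by linarith) (by linarith) (by linarith) (by
      rw [Set.disjoint_left] at hdis ⊢
      intro s hs hsS
      exact hdis (a := 1 - s) ⟨by linarith [hs.2], by linarith [hs.1]⟩ ⟨s, hsS, rfl⟩)
    have hmap : MapsTo (fun s : ℝ ↦ -1 * s + 1) (Icc a b) (Icc (1 - b) (1 - a)) :=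
      fun s hs ↦ ⟨by linarith [hs.2], by linarith [hs.1]⟩
    have he : ∀ s : ℝ, 1 - s = -1 * s + 1 := fun s ↦ by ring
    exact ⟨contMDiffOn_comp_affine hs hmap
        (fun s _ ↦ by rw [Path.extend_symm_apply, he]),
      hpar.comp_affine hmap (fun s _ ↦ by rw [Path.extend_symm_apply, he]) (fun s _ ↦ by rw [he])⟩

theorem IsParallelAlong.piecewiseSmooth {g : SemiRiemannianMetric E M} {x y : M} {γ : Path x y}
    {X : ℝ → TangentBundle 𝓘(ℝ, E) M} (h : IsParallelAlong g γ X) :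
    PiecewiseSmooth (E := E) γ := by
  obtain ⟨-, S, hS, hX⟩ := h
  exact ⟨S, hS, fun a b ha hab hb hd ↦ (hX a b ha hab hb hd).1⟩

theorem IsParallelAlong.apply_one {g : SemiRiemannianMetric E M} {x y : M} {γ : Path x y}
    {X : ℝ → TangentBundle 𝓘(ℝ, E) M} (h : IsParallelAlong g γ X) : X 1 = ⟨y, ((X 1).2 : E)⟩ :=
  tangentBundle_ext ((h.1 1 (right_mem_Icc.2 zero_le_one)).trans γ.extend_one) rfl

/-- The scalar product on a tangent space, as a bilinear form on the model space. -/
def modelInner (g : SemiRiemannianMetric E M) (x : M) : E →L[ℝ] E →L[ℝ] ℝ := g.inner x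

theorem IsParallelAlong.inner_eq {g : SemiRiemannianMetric E M} {x y : M} {γ : Path x y}
    {X Y : ℝ → TangentBundle 𝓘(ℝ, E) M} (hX : IsParallelAlong g γ X) (hY : IsParallelAlong g γ Y)
    {v v' w w' : E} (hX0 : X 0 = ⟨x, v⟩) (hY0 : Y 0 = ⟨x, v'⟩) (hX1 : X 1 = ⟨y, w⟩)
    (hY1 : Y 1 = ⟨y, w'⟩) :
    modelInner g x v v' = modelInner g y w w' := by
  obtain ⟨hXp, S, hS, hX⟩ := hX
  obtain ⟨hYp, T, hT, hY⟩ := hY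
  let F : ℝ → ℝ := fun t ↦ modelInner g (γ.extend t) (X t).2 (Y t).2
  have hF : F 0 = F 1 := by
    refine relation_Icc_of_finite zero_le_one (fun r s ↦ F r = F s) (hS.union hT) (fun _ ↦ rfl)
      (fun r s t _ _ _ _ h1 h2 ↦ h1.trans h2) fun r s hr hrs hs hdis ↦ ?_
    rw [disjoint_union_right] at hdis
    exact (hX r s hr hrs hs hdis.1).2.inner_eq hrs.le γ.continuous_extend.continuousOn
      (hY r s hr hrs hs hdis.2).2 (fun q hq ↦ hXp q ⟨hr.trans hq.1, hq.2.trans hs⟩)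
      (fun q hq ↦ hYp q ⟨hr.trans hq.1, hq.2.trans hs⟩)
  have h0 : F 0 = modelInner g x v v' := by
    simp only [F, γ.extend_zero]
    congr 1
    · congr 1
      exact congrArg (fun ξ : TangentBundle 𝓘(ℝ, E) M ↦ (ξ.2 : E)) hX0
    · exact congrArg (fun ξ : TangentBundle 𝓘(ℝ, E) M ↦ (ξ.2 : E)) hY0
  have h1 : F 1 = modelInner g y w w' := by
    simp only [F, γ.extend_one]
    congr 1
    · congr 1
      exact congrArg (fun ξ : TangentBundle 𝓘(ℝ, E) M ↦ (ξ.2 : E)) hX1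
    · exact congrArg (fun ξ : TangentBundle 𝓘(ℝ, E) M ↦ (ξ.2 : E)) hY1
  rw [← h0, ← h1, hF]

/-- Transport preserves scalar products and reaches every vector at `y`; a vector there is
determined by its scalar products, which forces both uniqueness and linearity. -/
theorem existsUnique_isParallelTransport (g : SemiRiemannianMetric E M) {x y : M} (γ : Path x y)
    (hγ : PiecewiseSmooth (E := E) γ) : ∃! A, IsParallelTransport g γ A := by
  have hfwd : ∀ v : E, ∃ w : E, ∃ X : ℝ → TangentBundle 𝓘(ℝ, E) M,
      IsParallelAlong g γ X ∧ X 0 = ⟨x, v⟩ ∧ X 1 = ⟨y, w⟩ := fun v ↦ by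
    obtain ⟨X, hX, hX0⟩ := exists_isParallelAlong g hγ v
    exact ⟨(X 1).2, X, hX, hX0, hX.apply_one⟩
  have hγs : PiecewiseSmooth (E := E) γ.symm := by
    obtain ⟨X, hX, -⟩ := exists_isParallelAlong g hγ 0
    exact hX.symm.piecewiseSmooth
  -- Transport along the reversed curve, read backwards, produces a parallel field with prescribed
  -- end value.
  have hbwd : ∀ w : E, ∃ v : E, ∃ X : ℝ → TangentBundle 𝓘(ℝ, E) M,
      IsParallelAlong g γ X ∧ X 0 = ⟨x, v⟩ ∧ X 1 = ⟨y, w⟩ := fun w ↦ by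
    obtain ⟨X, hX, hX0⟩ := exists_isParallelAlong g hγs w
    refine ⟨(X 1).2, fun t ↦ X (1 - t), by simpa using hX.symm, ?_, by simpa using hX0⟩
    simpa using hX.apply_one
  choose T X hX hX0 hX1 using hfwd
  have hnd : ∀ w₁ w₂ : E, (∀ w' : E, modelInner g y w₁ w'
      = modelInner g y w₂ w') → w₁ = w₂ := fun w₁ w₂ h ↦ by
    rw [← sub_eq_zero]
    refine g.nondegenerate y _ fun (w' : E) ↦ ?_
    have h' : modelInner g y (w₁ - w₂) w' = 0 := by
      rw [map_sub, sub_apply, h w', sub_self]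
    exact h'
  have hinner : ∀ v v' : E, modelInner g y (T v) (T v')
      = modelInner g x v v' := fun v v' ↦
    ((hX v).inner_eq (hX v') (hX0 v) (hX0 v') (hX1 v) (hX1 v')).symm
  -- The scalar product of an end value with any `w'` equals that of the initial values, where `w'`
  -- is the end value of some parallel field `Z`.
  have huniq : ∀ (v w : E) (Y : ℝ → TangentBundle 𝓘(ℝ, E) M), IsParallelAlong g γ Y →
      Y 0 = ⟨x, v⟩ → Y 1 = ⟨y, w⟩ → w = T v := fun v w Y hY hY0 hY1 ↦ by
    refine hnd _ _ fun w' ↦ ?_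
    obtain ⟨v', Z, hZ, hZ0, hZ1⟩ := hbwd w'
    rw [← hY.inner_eq hZ hY0 hZ0 hY1 hZ1, ← (hX v).inner_eq hZ (hX0 v) hZ0 (hX1 v) hZ1]
  have hsurj : ∀ w, ∃ v, T v = w := fun w ↦ by
    obtain ⟨v, Y, hY, hY0, hY1⟩ := hbwd w
    exact ⟨v, (huniq v w Y hY hY0 hY1).symm⟩
  -- Linearity is tested against vectors `T u`, which exhaust the space; there `hinner` moves the
  -- identity back to `x`, where it is bilinearity.
  let L : E →ₗ[ℝ] E :=
    { toFun := T
      map_add' := fun v v' ↦ hnd _ _ fun w' ↦ by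
        obtain ⟨u, rfl⟩ := hsurj w'
        simp only [map_add, add_apply, hinner]
      map_smul' := fun k v ↦ hnd _ _ fun w' ↦ by
        obtain ⟨u, rfl⟩ := hsurj w'
        simp only [map_smul, smul_apply, hinner, RingHom.id_apply] }
  have hLinj : Function.Injective L :=
    LinearMap.injective_iff_surjective.2 hsurj
  let A : E ≃L[ℝ] E := (LinearEquiv.ofBijective L ⟨hLinj, hsurj⟩).toContinuousLinearEquiv
  refine ⟨A, fun v ↦ ⟨X v, hX v, hX0 v, hX1 v⟩, fun B hB ↦ ?_⟩
  ext v
  obtain ⟨Y, hY, hY0, hY1⟩ := hB v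
  exact huniq v (B v) Y hY hY0 hY1

/-! ### Naturality of parallel transport -/

/-- The differential of a map, as an endomorphism of the model space. -/
def modelDeriv (f : M → N) (x : M) : E →L[ℝ] E := mfderiv 𝓘(ℝ, E) 𝓘(ℝ, E) f x

/-- A vector killed by the differential is orthogonal to everything in the source metric. -/
theorem modelDeriv_injective {g : SemiRiemannianMetric E M} {h : SemiRiemannianMetric E N}
    {f : M → N} (hfg : PreservesMetric g h f) (x : M) :
    Function.Injective (modelDeriv (E := E) f x) := by
  rw [injective_iff_map_eq_zero]
  intro v hv
  refine g.nondegenerate x v fun w ↦ ?_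
  have h1 : modelInner h (f x) (modelDeriv f x v) (modelDeriv f x w) = g.inner x v w := hfg x v w
  rw [← h1, hv, map_zero]
  rfl

/-- The differential of a metric preserving map, as a linear isomorphism. -/
def modelDerivEquiv {g : SemiRiemannianMetric E M} {h : SemiRiemannianMetric E N} {f : M → N}
    (hfg : PreservesMetric g h f) (x : M) : E ≃L[ℝ] E :=
  (LinearEquiv.ofInjectiveEndo (modelDeriv (E := E) f x : E →ₗ[ℝ] E)
    (modelDeriv_injective hfg x)).toContinuousLinearEquiv

theorem modelDerivEquiv_apply {g : SemiRiemannianMetric E M} {h : SemiRiemannianMetric E N}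
    {f : M → N} (hfg : PreservesMetric g h f) (x : M) (v : E) :
    modelDerivEquiv hfg x v = modelDeriv f x v := rfl

theorem Path.extend_eq_of_lift {x y : M} {x' y' : N} {f : M → N} {γ : Path x y} {δ : Path x' y'}
    (hδ : ∀ t, f (γ t) = δ t) (t : ℝ) : δ.extend t = f (γ.extend t) :=
  (hδ (projIcc 0 1 zero_le_one t)).symm

theorem IsParallelAlong.map {g : SemiRiemannianMetric E M} {h : SemiRiemannianMetric E N}
    {f : M → N} (hf : ContMDiff 𝓘(ℝ, E) 𝓘(ℝ, E) ∞ f) (hfg : PreservesMetric g h f)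
    {x y : M} {x' y' : N} {γ : Path x y} {δ : Path x' y'} (hδ : ∀ t, f (γ t) = δ t)
    {X : ℝ → TangentBundle 𝓘(ℝ, E) M} (hX : IsParallelAlong g γ X) :
    IsParallelAlong h δ (fun t ↦ tangentMap 𝓘(ℝ, E) 𝓘(ℝ, E) f (X t)) := by
  obtain ⟨hp, S, hS, hX⟩ := hX
  have hext : δ.extend = f ∘ γ.extend := funext (Path.extend_eq_of_lift hδ)
  refine ⟨fun t ht ↦ ?_, S, hS, fun a b ha hab hb hdis ↦ ?_⟩
  · rw [hext]
    exact congrArg f (hp t ht)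
  · obtain ⟨h1, h2⟩ := hX a b ha hab hb hdis
    rw [hext]
    exact ⟨hf.comp_contMDiffOn h1, h2.map hf hfg (fun r hr ↦ hp r ⟨ha.trans hr.1, hr.2.trans hb⟩)
      γ.continuous_extend.continuousOn⟩

/-- Metric preserving maps intertwine parallel transports. -/
theorem IsParallelTransport.map {g : SemiRiemannianMetric E M} {h : SemiRiemannianMetric E N}
    {f : M → N} (hf : ContMDiff 𝓘(ℝ, E) 𝓘(ℝ, E) ∞ f) (hfg : PreservesMetric g h f)
    {x y : M} {x' y' : N} {γ : Path x y} {δ : Path x' y'} (hδ : ∀ t, f (γ t) = δ t)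
    {A : E ≃L[ℝ] E} (hA : IsParallelTransport g γ A) :
    IsParallelTransport h δ
      ((modelDerivEquiv hfg x).symm.trans (A.trans (modelDerivEquiv hfg y))) := by
  intro v
  obtain ⟨X, hX, hX0, hX1⟩ := hA ((modelDerivEquiv hfg x).symm v)
  refine ⟨_, hX.map hf hfg hδ, ?_, ?_⟩
  · rw [hX0]
    refine tangentBundle_ext ?_ ?_
    · simpa using hδ 0
    · exact (modelDerivEquiv hfg x).apply_symm_apply v
  · rw [hX1]
    refine tangentBundle_ext ?_ rfl
    simpa using hδ 1

theorem IsParallelTransport.unique {g : SemiRiemannianMetric E M} {x y : M} {γ : Path x y}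
    {A B : TangentSpace 𝓘(ℝ, E) x ≃L[ℝ] TangentSpace 𝓘(ℝ, E) y} (hA : IsParallelTransport g γ A)
    (hB : IsParallelTransport g γ B) : A = B :=
  (existsUnique_isParallelTransport g γ hA.piecewiseSmooth).unique hA hB

/-! ### Piecewise smooth curves: images, lifts, joining points -/

theorem PiecewiseSmooth.map {f : M → N} (hf : ContMDiff 𝓘(ℝ, E) 𝓘(ℝ, E) ∞ f)
    {x y : M} {x' y' : N} {γ : Path x y} {δ : Path x' y'} (hδ : ∀ t, f (γ t) = δ t)
    (hγ : PiecewiseSmooth (E := E) γ) : PiecewiseSmooth (E := E) δ := by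
  obtain ⟨S, hS, hγ⟩ := hγ
  refine ⟨S, hS, fun a b ha hab hb hdis ↦ ?_⟩
  rw [funext (Path.extend_eq_of_lift hδ)]
  exact hf.comp_contMDiffOn (hγ a b ha hab hb hdis)

/-- Lifts of piecewise smooth curves through local diffeomorphisms are piecewise smooth. -/
theorem PiecewiseSmooth.lift {f : M → N} (hf : IsLocalDiffeomorph 𝓘(ℝ, E) 𝓘(ℝ, E) ∞ f)
    {x y : M} {x' y' : N} {γ : Path x y} {δ : Path x' y'} (hδ : ∀ t, f (γ t) = δ t)
    (h : PiecewiseSmooth (E := E) δ) : PiecewiseSmooth (E := E) γ := by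
  obtain ⟨S, hS, h⟩ := h
  refine ⟨S, hS, fun a b ha hab hb hdis t ht ↦ ?_⟩
  obtain ⟨Ψ, hΨ, heq⟩ := hf (γ.extend t)
  have hδt : δ.extend t = Ψ (γ.extend t) := (Path.extend_eq_of_lift hδ t).trans (heq hΨ)
  have h1 : ContMDiffAt 𝓘(ℝ, E) 𝓘(ℝ, E) ∞ Ψ.symm (δ.extend t) :=
    Ψ.contMDiffOn_invFun.contMDiffAt (Ψ.open_target.mem_nhds (hδt ▸ Ψ.map_source hΨ))
  have h2 := h1.comp_contMDiffWithinAt t (h a b ha hab hb hdis t ht)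
  refine h2.congr_of_eventuallyEq ?_ ?_
  · have hmem : ∀ᶠ r in 𝓝[Icc a b] t, γ.extend r ∈ Ψ.source :=
      γ.continuous_extend.continuousAt.continuousWithinAt.eventually (Ψ.open_source.mem_nhds hΨ)
    filter_upwards [hmem] with r hr
    rw [Function.comp, Path.extend_eq_of_lift hδ r, heq hr]
    exact (Ψ.left_inv hr).symm
  · rw [Function.comp, hδt]
    exact (Ψ.left_inv hΨ).symm

/-- The metric serves only to exhibit a transport: reversal of transports already contains reversal
of the curve. -/
theorem PiecewiseSmooth.symm (g : SemiRiemannianMetric E M) {x y : M} {γ : Path x y}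
    (hγ : PiecewiseSmooth (E := E) γ) : PiecewiseSmooth (E := E) γ.symm := by
  obtain ⟨A, hA, -⟩ := existsUnique_isParallelTransport g γ hγ
  exact hA.symm.piecewiseSmooth

theorem PiecewiseSmooth.trans (g : SemiRiemannianMetric E M) {x y z : M} {γ : Path x y}
    {δ : Path y z} (hγ : PiecewiseSmooth (E := E) γ) (hδ : PiecewiseSmooth (E := E) δ) :
    PiecewiseSmooth (E := E) (γ.trans δ) := by
  obtain ⟨A, hA, -⟩ := existsUnique_isParallelTransport g γ hγ
  obtain ⟨B, hB, -⟩ := existsUnique_isParallelTransport g δ hδ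
  exact (hA.trans hB).piecewiseSmooth

/-- Points near `x` are joined to it by straight segments in a coordinate ball. -/
theorem eventually_exists_piecewiseSmooth (x : M) :
    ∀ᶠ y in 𝓝 x, ∃ γ : Path x y, PiecewiseSmooth (E := E) γ := by
  set e := chartAt E x
  have he : e ∈ atlas E M := chart_mem_atlas E x
  have hx : x ∈ e.source := mem_chart_source E x
  obtain ⟨ε, hε, hball⟩ := Metric.isOpen_iff.1 e.open_target (e x) (e.map_source hx)
  filter_upwards [e.open_source.mem_nhds hx,
    (e.continuousAt hx).eventually (Metric.ball_mem_nhds (e x) hε)] with y hy hyb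
  have hline : ∀ t ∈ Icc (0 : ℝ) 1, AffineMap.lineMap (e x) (e y) t ∈ e.target := fun t ht ↦
    hball ((convex_ball (e x) ε).lineMap_mem (Metric.mem_ball_self hε) hyb ht)
  have hlc : ContDiff ℝ ∞ (fun t : ℝ ↦ AffineMap.lineMap (e x) (e y) t) := by
    simp only [AffineMap.lineMap_apply_module]
    fun_prop
  let γ : Path x y :=
    { toFun := fun t ↦ e.symm (AffineMap.lineMap (e x) (e y) (t : ℝ))
      continuous_toFun := e.continuousOn_symm.comp_continuous
        (hlc.continuous.comp continuous_subtype_val) fun t ↦ hline t t.2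
      source' := by simp [e.left_inv hx]
      target' := by simp [e.left_inv hy] }
  refine ⟨γ, ∅, finite_empty, fun a b ha hab hb _ ↦ ?_⟩
  have h1 : ContMDiffOn 𝓘(ℝ, ℝ) 𝓘(ℝ, E) ∞
      (e.symm ∘ fun t : ℝ ↦ AffineMap.lineMap (e x) (e y) t) (Icc a b) :=
    (contMDiffOn_chart_symm' he).comp hlc.contMDiff.contMDiffOn
      fun t ht ↦ hline t ⟨ha.trans ht.1, ht.2.trans hb⟩
  exact h1.congr fun t ht ↦ γ.extend_apply ⟨ha.trans ht.1, ht.2.trans hb⟩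

/-- Any two points of a connected semi-Riemannian manifold are joined by a piecewise smooth curve. -/
theorem exists_piecewiseSmooth [PreconnectedSpace M] (g : SemiRiemannianMetric E M) (x y : M) :
    ∃ γ : Path x y, PiecewiseSmooth (E := E) γ := by
  -- A transitive relation that holds in both directions between each point and its neighbours holds
  -- between all points of a preconnected space.
  refine PreconnectedSpace.induction₂' (fun x y ↦ ∃ γ : Path x y, PiecewiseSmooth (E := E) γ)
    (fun x ↦ ?_) ⟨fun x y z ⟨γ, hγ⟩ ⟨δ, hδ⟩ ↦ ⟨γ.trans δ, hγ.trans g hδ⟩⟩ x y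
  filter_upwards [eventually_exists_piecewiseSmooth (E := E) x] with y ⟨γ, hγ⟩
  exact ⟨⟨γ, hγ⟩, ⟨γ.symm, hγ.symm g⟩⟩

/-! ### Freeness of the action and path lifting -/

theorem eq_of_smul_eq_smul {Γ X : Type*} [Group Γ] [TopologicalSpace X] [MulAction Γ X]
    (hΓ : ActsProperlyDiscontinuously Γ X) {σ τ : Γ} {x : X} (h : σ • x = τ • x) : σ = τ := by
  obtain ⟨U, hU, hd⟩ := hΓ.pd1 x
  by_contra hne
  have h1 : τ⁻¹ * σ ≠ 1 := fun h1 ↦ hne (inv_mul_eq_one.1 h1).symm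
  refine Set.disjoint_left.1 (hd _ h1) ⟨x, mem_of_mem_nhds hU, ?_⟩ (mem_of_mem_nhds hU)
  simp only [mul_smul, h, inv_smul_smul]

section Covering

variable {Γ : Type*} [Group Γ] [MulAction Γ M] {π : M → N}

theorem exists_lift_orbit (hπ : IsCoveringMap π)
    (hquot : ∀ x y : M, π x = π y ↔ x ∈ MulAction.orbit Γ y) (p' : M)
    (γ : Path (π p') (π p')) :
    ∃ σ : Γ, ∃ γ' : Path p' (σ⁻¹ • p'), ∀ t, π (γ' t) = γ t := by
  have h0 : (γ : C(unitInterval, N)) 0 = π p' := γ.source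
  let L := hπ.liftPath (γ : C(unitInterval, N)) p' h0
  have hL : ∀ t, π (L t) = γ t := fun t ↦ congrFun (hπ.liftPath_lifts γ p' h0) t
  obtain ⟨τ, hτ⟩ := (hquot (L 1) p').1 ((hL 1).trans γ.target)
  -- The lift ends at `τ • p'`, and the convention asks for the end point in the form `σ⁻¹ • p'`.
  refine ⟨τ⁻¹, ⟨L, hπ.liftPath_zero γ p' h0, ?_⟩, hL⟩
  simpa using hτ.symm

theorem lift_target_unique (hπ : IsCoveringMap π) {p' q r : M} {y : N} {γ : Path (π p') y}
    {γ₁ : Path p' q} {γ₂ : Path p' r} (h₁ : ∀ t, π (γ₁ t) = γ t) (h₂ : ∀ t, π (γ₂ t) = γ t) :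
    q = r := by
  have h0 : (γ : C(unitInterval, N)) 0 = π p' := γ.source
  have e₁ := (hπ.eq_liftPath_iff' (γ := γ) (e := p') (γ_0 := h0)
    (Γ := (γ₁ : C(unitInterval, M)))).2 ⟨funext h₁, γ₁.source⟩
  have e₂ := (hπ.eq_liftPath_iff' (γ := γ) (e := p') (γ_0 := h0)
    (Γ := (γ₂ : C(unitInterval, M)))).2 ⟨funext h₂, γ₂.source⟩
  have := DFunLike.congr_fun (e₁.trans e₂.symm) 1
  simpa using this

end Covering

theorem lift_trans {X Y : Type*} [TopologicalSpace X] [TopologicalSpace Y] {π : X → Y}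
    {x y z : X} {x' y' z' : Y} {γ : Path x y} {δ : Path y z} {γ' : Path x' y'} {δ' : Path y' z'}
    (hγ : ∀ t, π (γ t) = γ' t) (hδ : ∀ t, π (δ t) = δ' t) (t : unitInterval) :
    π (γ.trans δ t) = γ'.trans δ' t := by
  rw [Path.trans_apply, Path.trans_apply]
  split_ifs
  · exact hγ _
  · exact hδ _

/-! ### The induced homomorphism of holonomy groups -/

/-- A holonomy transformation, as an isomorphism of the model space. -/
def modelHolonomy {g : SemiRiemannianMetric E M} {p : M} (a : holonomyGroup g p) : E ≃L[ℝ] E := a.1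

/-- The homomorphism of holonomy groups induced by a smooth metric preserving map. -/
def holonomyMap {g : SemiRiemannianMetric E M} {h : SemiRiemannianMetric E N} {f : M → N}
    (hf : ContMDiff 𝓘(ℝ, E) 𝓘(ℝ, E) ∞ f) (hfg : PreservesMetric g h f) (p : M) :
    holonomyGroup g p →* holonomyGroup h (f p) where
  -- The value depends on the transformation alone; a loop is chosen only to prove membership.
  -- Well-definedness therefore needs no argument.
  toFun a := ⟨(modelDerivEquiv hfg p).symm.trans ((modelHolonomy a).trans (modelDerivEquiv hfg p)), by
    obtain ⟨γ, hγ, hA⟩ := a.2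
    have := hA.map hf hfg (δ := γ.map hf.continuous) (fun _ ↦ rfl)
    exact ⟨_, this.piecewiseSmooth, this⟩⟩
  map_one' := by
    refine Subtype.ext (ContinuousLinearEquiv.ext (funext fun v ↦ ?_))
    exact (modelDerivEquiv hfg p).apply_symm_apply v
  map_mul' a b := by
    refine Subtype.ext (ContinuousLinearEquiv.ext (funext fun v ↦ ?_))
    have h1 := (modelDerivEquiv hfg p).symm_apply_apply
      (modelHolonomy b ((modelDerivEquiv hfg p).symm v))
    exact congrArg (fun w ↦ modelDerivEquiv hfg p (modelHolonomy a w)) h1.symm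

theorem modelHolonomy_holonomyMap {g : SemiRiemannianMetric E M} {h : SemiRiemannianMetric E N} {f : M → N}
    (hf : ContMDiff 𝓘(ℝ, E) 𝓘(ℝ, E) ∞ f) (hfg : PreservesMetric g h f) (p : M)
    (a : holonomyGroup g p) : modelHolonomy (holonomyMap hf hfg p a)
      = (modelDerivEquiv hfg p).symm.trans ((modelHolonomy a).trans (modelDerivEquiv hfg p)) := rfl

theorem holonomyMap_injective {g : SemiRiemannianMetric E M} {h : SemiRiemannianMetric E N}
    {f : M → N} (hf : ContMDiff 𝓘(ℝ, E) 𝓘(ℝ, E) ∞ f) (hfg : PreservesMetric g h f) (p : M) :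
    Function.Injective (holonomyMap hf hfg p) := by
  intro a b hab
  refine Subtype.ext (ContinuousLinearEquiv.ext (funext fun (v : E) ↦ ?_))
  have h1 := congrArg (fun c : holonomyGroup h (f p) ↦
    modelHolonomy c (modelDerivEquiv hfg p v)) hab
  simp only [modelHolonomy_holonomyMap, ContinuousLinearEquiv.trans_apply,
    ContinuousLinearEquiv.symm_apply_apply] at h1
  exact (modelDerivEquiv hfg p).injective h1

theorem IsParallelTransport.holonomyMap {g : SemiRiemannianMetric E M}
    {h : SemiRiemannianMetric E N} {f : M → N} (hf : ContMDiff 𝓘(ℝ, E) 𝓘(ℝ, E) ∞ f)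
    (hfg : PreservesMetric g h f) {p : M} {γ : Path p p} {δ : Path (f p) (f p)}
    (hδ : ∀ t, f (γ t) = δ t) {a : holonomyGroup g p} (ha : IsParallelTransport g γ a) :
    IsParallelTransport h δ (holonomyMap hf hfg p a) :=
  ha.map hf hfg hδ

/-! ### Holonomy transformations over elements of the group -/

section Covering

variable {Γ : Type*} [Group Γ] [MulAction Γ M] {π : M → N}

/-- `a` is the parallel transport along a loop at `π p'` whose lift from `p'` ends at
`σ⁻¹ • p'`. -/
def IsHolonomyOver (h : SemiRiemannianMetric E N) (π : M → N) (p' : M) (σ : Γ)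
    (a : holonomyGroup h (π p')) : Prop :=
  ∃ (γ : Path (π p') (π p')) (γ' : Path p' (σ⁻¹ • p')), (∀ t, π (γ' t) = γ t) ∧
    IsParallelTransport h γ a

variable {g : SemiRiemannianMetric E M} {h : SemiRiemannianMetric E N} {p' : M}

/-- The product `a * b` transports along `δ` first. The lift `δ'` ends at `τ⁻¹ • p'`, so it is
continued by the translate of `γ'` under `τ⁻¹`, ending at `τ⁻¹ • σ⁻¹ • p' = (σ * τ)⁻¹ • p'`. The
inverse in the convention makes the order come out right. -/
theorem IsHolonomyOver.mul (hiso : ActsByIsometries Γ g) (hσ : ∀ (σ : Γ) x, π (σ • x) = π x)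
    {σ τ : Γ} {a b : holonomyGroup h (π p')} (ha : IsHolonomyOver h π p' σ a)
    (hb : IsHolonomyOver h π p' τ b) : IsHolonomyOver h π p' (σ * τ) (a * b) := by
  obtain ⟨γ, γ', hγ, hA⟩ := ha
  obtain ⟨δ, δ', hδ, hB⟩ := hb
  refine ⟨δ.trans γ, (δ'.trans (γ'.map (hiso.contMDiff τ⁻¹).continuous)).cast rfl
    (by rw [mul_inv_rev, mul_smul]), ?_, hB.trans hA⟩
  refine lift_trans hδ fun t ↦ ?_
  rw [← hγ t]
  exact hσ _ _

/-- The reversed lift starts at `σ⁻¹ • p'`; translating it by `σ` moves its start to `p'` and its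
end to `σ • p'`. -/
theorem IsHolonomyOver.inv (hiso : ActsByIsometries Γ g) (hσ : ∀ (σ : Γ) x, π (σ • x) = π x)
    {σ : Γ} {a : holonomyGroup h (π p')} (ha : IsHolonomyOver h π p' σ a) :
    IsHolonomyOver h π p' σ⁻¹ a⁻¹ := by
  obtain ⟨γ, γ', hγ, hA⟩ := ha
  refine ⟨γ.symm, (γ'.symm.map (hiso.contMDiff σ).continuous).cast (by rw [smul_inv_smul])
    (by rw [inv_inv]), fun t ↦ ?_, hA.symm⟩
  exact (hσ σ _).trans (hγ _)

/-- Over `1` the lift is closed, and its own transport is the preimage under `holonomyMap`.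
Conversely, a loop upstairs lifts its projection. -/
theorem isHolonomyOver_one_iff (hπ : IsSemiRiemannianCovering g h π)
    {a : holonomyGroup h (π p')} : IsHolonomyOver h π p' (1 : Γ) a ↔
      a ∈ (holonomyMap hπ.isLocalDiffeomorph.contMDiff hπ.preservesMetric p').range := by
  constructor
  · rintro ⟨γ, γ', hγ, hA⟩
    have hps := PiecewiseSmooth.lift hπ.isLocalDiffeomorph hγ hA.piecewiseSmooth
    obtain ⟨A', hA', -⟩ := existsUnique_isParallelTransport g _ hps
    -- The end point `1⁻¹ • p'` is not definitionally `p'`, so it is replaced by a variable.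
    have hcast : ∀ (q : M) (hq : q = p') (γ₁ : Path p' q) (B : E ≃L[ℝ] E),
        (∀ t, π (γ₁ t) = γ t) → IsParallelTransport g γ₁ B →
        a ∈ (holonomyMap hπ.isLocalDiffeomorph.contMDiff hπ.preservesMetric p').range := by
      rintro q rfl γ₁ B hγ₁ hB
      refine ⟨⟨B, γ₁, hB.piecewiseSmooth, hB⟩, Subtype.ext ?_⟩
      exact (IsParallelTransport.holonomyMap hπ.isLocalDiffeomorph.contMDiff hπ.preservesMetric
        hγ₁ (a := ⟨B, γ₁, hB.piecewiseSmooth, hB⟩) hB).unique hA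
    exact hcast _ (by simp) γ' A' hγ hA'
  · rintro ⟨⟨A, γ, hγ, hA⟩, rfl⟩
    refine ⟨γ.map hπ.isCoveringMap.continuous, γ.cast rfl (by simp), fun _ ↦ rfl, ?_⟩
    exact IsParallelTransport.holonomyMap hπ.isLocalDiffeomorph.contMDiff hπ.preservesMetric
      (fun _ ↦ rfl) (a := ⟨A, γ, hγ, hA⟩) hA

/-- Connectedness enters here: a piecewise smooth curve from `p'` to `σ⁻¹ • p'` projects to a loop.
-/
theorem exists_isHolonomyOver_of_group [PreconnectedSpace M]
    (hπ : IsSemiRiemannianCovering g h π) (hσ : ∀ (σ : Γ) x, π (σ • x) = π x) (σ : Γ) :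
    ∃ a : holonomyGroup h (π p'), IsHolonomyOver h π p' σ a := by
  obtain ⟨γ', hγ'⟩ := exists_piecewiseSmooth g p' (σ⁻¹ • p')
  let γ : Path (π p') (π p') := (γ'.map hπ.isCoveringMap.continuous).cast rfl (hσ _ _).symm
  have hγ := PiecewiseSmooth.map hπ.isLocalDiffeomorph.contMDiff (δ := γ) (fun _ ↦ rfl) hγ'
  obtain ⟨A, hA, -⟩ := existsUnique_isParallelTransport h γ hγ
  exact ⟨⟨A, γ, hγ, hA⟩, γ, γ', fun _ ↦ rfl, hA⟩

theorem exists_isHolonomyOver_of_holonomy (hπ : IsCoveringMap π)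
    (hquot : ∀ x y : M, π x = π y ↔ x ∈ MulAction.orbit Γ y) (a : holonomyGroup h (π p')) :
    ∃ σ : Γ, IsHolonomyOver h π p' σ a := by
  obtain ⟨γ, -, hA⟩ := a.2
  obtain ⟨σ, γ', hγ'⟩ := exists_lift_orbit hπ hquot p' γ
  exact ⟨σ, γ, γ', hγ', hA⟩

theorem modelDeriv_smul {hσ : ∀ (σ : Γ) x, π (σ • x) = π x} (hiso : ActsByIsometries Γ g)
    (hπ : ContMDiff 𝓘(ℝ, E) 𝓘(ℝ, E) ∞ π) (σ : Γ) (x : M) (v : E) :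
    modelDeriv π (σ • x) (modelDeriv (fun y : M ↦ σ • y) x v) = modelDeriv (E := E) π x v := by
  have h1 : MDifferentiableAt 𝓘(ℝ, E) 𝓘(ℝ, E) (fun y : M ↦ σ • y) x :=
    (hiso.contMDiff σ).mdifferentiableAt (by simp)
  have h2 : MDifferentiableAt 𝓘(ℝ, E) 𝓘(ℝ, E) π (σ • x) := hπ.mdifferentiableAt (by simp)
  have h3 := mfderiv_comp x h2 h1
  have h4 : π ∘ (fun y : M ↦ σ • y) = π := funext (hσ σ)
  rw [h4] at h3
  exact (DFunLike.congr_fun h3 v).symm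

theorem modelDeriv_inv_smul (hiso : ActsByIsometries Γ g) (σ : Γ) (x : M) (v : E) :
    modelDeriv (fun y : M ↦ σ⁻¹ • y) (σ • x) (modelDeriv (fun y : M ↦ σ • y) x v) = v := by
  have h1 : MDifferentiableAt 𝓘(ℝ, E) 𝓘(ℝ, E) (fun y : M ↦ σ • y) x :=
    (hiso.contMDiff σ).mdifferentiableAt (by simp)
  have h2 : MDifferentiableAt 𝓘(ℝ, E) 𝓘(ℝ, E) (fun y : M ↦ σ⁻¹ • y) (σ • x) :=
    (hiso.contMDiff σ⁻¹).mdifferentiableAt (by simp)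
  have h3 := mfderiv_comp x h2 h1
  have h4 : (fun y : M ↦ σ⁻¹ • y) ∘ (fun y : M ↦ σ • y) = id := funext fun y ↦ inv_smul_smul σ y
  rw [h4, mfderiv_id] at h3
  exact (DFunLike.congr_fun h3 v).symm

/-- Naturality under `π` expresses `A` through the differentials at `p'` and at `σ⁻¹ • p'`.
Differentiating `π ∘ σ = π` rewrites the latter as the differential at `p'` after that of `σ`. -/
theorem transport_eq_of_lift (hπ : IsSemiRiemannianCovering g h π)
    (hiso : ActsByIsometries Γ g) (hσ : ∀ (σ : Γ) x, π (σ • x) = π x) {σ : Γ}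
    {γ : Path (π p') (π p')} {γ' : Path p' (σ⁻¹ • p')} (hγ : ∀ t, π (γ' t) = γ t)
    {A A' : E ≃L[ℝ] E} (hA : IsParallelTransport h γ A) (hA' : IsParallelTransport g γ' A')
    (v : E) : A (modelDeriv π p' v)
      = modelDeriv π p' (modelDeriv (fun y : M ↦ σ • y) (σ⁻¹ • p') (A' v)) := by
  have hC := hπ.isLocalDiffeomorph.contMDiff
  have h1 : A (modelDeriv π p' v) = modelDerivEquiv hπ.preservesMetric (σ⁻¹ • p')
      (A' ((modelDerivEquiv hπ.preservesMetric p').symm (modelDeriv π p' v))) :=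
    DFunLike.congr_fun (hA.unique (hA'.map hC hπ.preservesMetric hγ)) (modelDeriv π p' v)
  have h2 := modelDeriv_smul (hσ := hσ) hiso hC σ (σ⁻¹ • p') (A' v)
  rw [smul_inv_smul] at h2
  rw [h2, h1, ← modelDerivEquiv_apply hπ.preservesMetric, ← modelDerivEquiv_apply hπ.preservesMetric,
    ContinuousLinearEquiv.symm_apply_apply]

/-- Since `σ⁻¹` preserves the metric, its differential is an isomorphism and
`ContinuousLinearMap.inverse` does not take its default value; the chain rule identifies the
inverse. -/
theorem modelDeriv_eq_inverse (hiso : ActsByIsometries Γ g) (σ : Γ) (x : M) (w : E) :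
    modelDeriv (fun y : M ↦ σ • y) (σ⁻¹ • x) w
      = ContinuousLinearMap.inverse (modelDeriv (E := E) (fun y : M ↦ σ⁻¹ • y) x) w := by
  have h1 := modelDeriv_inv_smul hiso σ (σ⁻¹ • x) w
  rw [smul_inv_smul] at h1
  let T := modelDerivEquiv (hiso.preservesMetric σ⁻¹) x
  have hT : modelDeriv (E := E) (fun y : M ↦ σ⁻¹ • y) x = (T : E →L[ℝ] E) := rfl
  rw [hT] at h1 ⊢
  rw [ContinuousLinearMap.inverse_equiv]
  exact (T.symm_apply_eq.2 h1.symm).symm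

end Covering

end HolonomyCovering

end

/-! ### The proposition -/

open HolonomyCovering in
theorem mainTheorem4
    {E : Type*} [NormedAddCommGroup E] [NormedSpace ℝ E] [FiniteDimensional ℝ E]
    {M' : Type*} [TopologicalSpace M'] [T2Space M'] [SecondCountableTopology M']
    [ConnectedSpace M'] [ChartedSpace E M'] [IsManifold 𝓘(ℝ, E) ∞ M']
    (g' : SemiRiemannianMetric E M')
    {Γ : Type*} [Group Γ] [MulAction Γ M']
    (hΓ : ActsProperlyDiscontinuously Γ M') (hiso : ActsByIsometries Γ g')
    {M : Type*} [TopologicalSpace M] [ChartedSpace E M] [IsManifold 𝓘(ℝ, E) ∞ M]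
    (g : SemiRiemannianMetric E M)
    (π : M' → M) (hπ : IsSemiRiemannianCovering g' g π)
    (hquot : ∀ x y : M', π x = π y ↔ x ∈ MulAction.orbit Γ y)
    (p' : M') :
    -- Parallel transports along piecewise smooth curves exist and are unique.
    (∀ (x y : M') (γ : Path x y), PiecewiseSmooth (E := E) γ → ∃! A, IsParallelTransport g' γ A) ∧
    (∀ (x y : M) (γ : Path x y), PiecewiseSmooth (E := E) γ → ∃! A, IsParallelTransport g γ A) ∧
    -- (i) `ι : P̃_γ̃ ↦ P_{π ∘ γ̃}` is an injective homomorphism with normal image.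
    ∃ ι : holonomyGroup g' p' →* holonomyGroup g (π p'),
      (∀ (γ' : Path p' p') (a : holonomyGroup g' p'), IsParallelTransport g' γ' a →
        IsParallelTransport g (γ'.map hπ.isCoveringMap.continuous) (ι a)) ∧
      Function.Injective ι ∧
      ∃ _ : ι.range.Normal,
        -- (ii) `Φ : σ ↦ [P_γ]` is a well-defined surjective homomorphism, where `γ` is a loop at `p`
        -- whose lift from `p̃` ends at `σ⁻¹ p̃`.
        (∀ σ : Γ, ∃ γ : Path (π p') (π p'), PiecewiseSmooth (E := E) γ ∧
          ∃ γ' : Path p' (σ⁻¹ • p'), ∀ t, π (γ' t) = γ t) ∧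
        ∃ Φ : Γ →* holonomyGroup g (π p') ⧸ ι.range,
          (∀ (σ : Γ) (γ : Path (π p') (π p')) (γ' : Path p' (σ⁻¹ • p')),
            PiecewiseSmooth (E := E) γ → (∀ t, π (γ' t) = γ t) →
            ∀ a : holonomyGroup g (π p'), IsParallelTransport g γ a →
              Φ σ = QuotientGroup.mk a) ∧
          Function.Surjective Φ ∧
          -- (iii) Every loop at `p` lifts, and the lift determines its parallel transport.
          (∀ γ : Path (π p') (π p'), PiecewiseSmooth (E := E) γ →
            ∃! σ : Γ, ∃ γ' : Path p' (σ⁻¹ • p'), ∀ t, π (γ' t) = γ t) ∧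
          (∀ (γ : Path (π p') (π p')) (σ : Γ) (γ' : Path p' (σ⁻¹ • p')),
            PiecewiseSmooth (E := E) γ → (∀ t, π (γ' t) = γ t) →
            PiecewiseSmooth (E := E) γ' ∧
            ∀ A A', IsParallelTransport g γ A → IsParallelTransport g' γ' A' →
              ∀ v, A (mfderiv 𝓘(ℝ, E) 𝓘(ℝ, E) π p' v)
                = mfderiv 𝓘(ℝ, E) 𝓘(ℝ, E) π p' (actionDifferential σ p' (A' v))) ∧
          (∀ (σ : Γ) (γ' : Path p' (σ⁻¹ • p')) A', IsParallelTransport g' γ' A' →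
            (∀ v, actionDifferential σ p' (A' v)
              = ContinuousLinearMap.inverse
                  (mfderiv 𝓘(ℝ, E) 𝓘(ℝ, E) (fun y : M' ↦ σ⁻¹ • y) p') (A' v)) ∧
            ∃ a : holonomyGroup g (π p'),
              (∀ v, (a : TangentSpace 𝓘(ℝ, E) (π p') ≃L[ℝ] TangentSpace 𝓘(ℝ, E) (π p'))
                  (mfderiv 𝓘(ℝ, E) 𝓘(ℝ, E) π p' v)
                = mfderiv 𝓘(ℝ, E) 𝓘(ℝ, E) π p' (actionDifferential σ p' (A' v))) ∧
              Φ σ = QuotientGroup.mk a) := by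
  have hC := hπ.isLocalDiffeomorph.contMDiff
  have hσ : ∀ (σ : Γ) x, π (σ • x) = π x := fun σ x ↦ (hquot _ _).2 ⟨σ, rfl⟩
  let ι := holonomyMap hC hπ.preservesMetric p'
  have hone : ∀ {a : holonomyGroup g (π p')}, IsHolonomyOver g π p' (1 : Γ) a ↔ a ∈ ι.range :=
    isHolonomyOver_one_iff hπ
  -- If `a` lies over `σ` and `n` over `1`, then the conjugate of `n` by `a` lies over `σ * 1 * σ⁻¹
  -- = 1`.
  have hnormal : ι.range.Normal := ⟨fun n hn a ↦ by
    obtain ⟨σ, ha⟩ := exists_isHolonomyOver_of_holonomy hπ.isCoveringMap hquot a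
    have h1 := (ha.mul hiso hσ (hone.2 hn)).mul hiso hσ (ha.inv hiso hσ)
    rw [mul_one, mul_inv_cancel] at h1
    exact hone.1 h1⟩
  -- Two transformations over the same `σ` differ by `a⁻¹ * b`, which lies over `1`. This is the
  -- independence of `Φ` from the loop.
  have hcoset : ∀ {σ : Γ} {a b : holonomyGroup g (π p')}, IsHolonomyOver g π p' σ a →
      IsHolonomyOver g π p' σ b →
      (QuotientGroup.mk a : holonomyGroup g (π p') ⧸ ι.range) = QuotientGroup.mk b := by
    intro σ a b ha hb
    have h1 := (ha.inv hiso hσ).mul hiso hσ hb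
    rw [inv_mul_cancel] at h1
    exact QuotientGroup.eq.2 (hone.1 h1)
  choose rep hrep using fun σ : Γ ↦ exists_isHolonomyOver_of_group (p' := p') hπ hσ σ
  let Φ : Γ →* holonomyGroup g (π p') ⧸ ι.range :=
    MonoidHom.mk' (fun σ ↦ QuotientGroup.mk (rep σ)) fun σ τ ↦ by
      rw [← QuotientGroup.mk_mul]
      exact hcoset (hrep (σ * τ)) ((hrep σ).mul hiso hσ (hrep τ))
  have hΦ : ∀ {σ : Γ} {a : holonomyGroup g (π p')}, IsHolonomyOver g π p' σ a →
      Φ σ = QuotientGroup.mk a := fun {σ a} ha ↦ hcoset (hrep σ) ha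
  refine ⟨fun x y γ hγ ↦ existsUnique_isParallelTransport g' γ hγ,
    fun x y γ hγ ↦ existsUnique_isParallelTransport g γ hγ, ι,
    fun γ' a ha ↦ ha.holonomyMap hC hπ.preservesMetric fun _ ↦ rfl,
    holonomyMap_injective hC hπ.preservesMetric p', hnormal, fun σ ↦ ?_, Φ,
    fun σ γ γ' _ hγ a ha ↦ hΦ ⟨γ, γ', hγ, ha⟩, fun c ↦ ?_, fun γ _ ↦ ?_,
    fun γ σ γ' hγ hlift ↦ ⟨hγ.lift hπ.isLocalDiffeomorph hlift, fun A A' hA hA' v ↦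
      transport_eq_of_lift hπ hiso hσ hlift hA hA' v⟩,
    fun σ γ' A' hA' ↦ ⟨fun v ↦ modelDeriv_eq_inverse hiso σ p' (A' v), ?_⟩⟩
  · obtain ⟨γ, γ', hγ, hA⟩ := hrep σ
    exact ⟨γ, hA.piecewiseSmooth, γ', hγ⟩
  · obtain ⟨a, rfl⟩ := QuotientGroup.mk_surjective c
    obtain ⟨σ, ha⟩ := exists_isHolonomyOver_of_holonomy hπ.isCoveringMap hquot a
    exact ⟨σ, hΦ ha⟩
  · obtain ⟨σ, γ', hγ'⟩ := exists_lift_orbit hπ.isCoveringMap hquot p' γ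
    -- Lifts from `p'` have the same end point, and a free action determines `σ⁻¹`, hence `σ`, from
    -- it.
    refine ⟨σ, ⟨γ', hγ'⟩, fun τ ⟨δ', hδ'⟩ ↦ inv_injective ?_⟩
    exact eq_of_smul_eq_smul hΓ (lift_target_unique hπ.isCoveringMap hδ' hγ')
  · let γ : Path (π p') (π p') := (γ'.map hπ.isCoveringMap.continuous).cast rfl (hσ _ _).symm
    have hγ := PiecewiseSmooth.map hC (δ := γ) (fun _ ↦ rfl) hA'.piecewiseSmooth
    obtain ⟨A, hA, -⟩ := existsUnique_isParallelTransport g γ hγ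
    exact ⟨⟨A, γ, hγ, hA⟩, fun v ↦ transport_eq_of_lift hπ hiso hσ (fun _ ↦ rfl) hA hA' v,
      hΦ ⟨γ, γ', fun _ ↦ rfl, hA⟩⟩
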